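/- Let $k\ge 2$, $\varepsilon>0$ and $\eta_{k,\varepsilon}=\varepsilon^2/(2\ln k)$. A \emph{directed (undirected) cycle cover} $C$ is a set of vertex-disjoint directed cycles of length at least $2$ (undirected cycles of length at least $3$) on the vertex set $\{0,\dots,n-1\}$ such that every vertex lies on exactly one of them; we identify it with its set of edges. Let $w=(w_1,\dots,w_k)$ be $k$ non-negative edge weights, put $w_i(S)=\sum_{e\in S}w_i(e)$ for sets $S$ of edges, and read inequalities between vectors component-wise. The pair $(C,w)$ is \emph{$\gamma$-light} if $w(e)\le w(C)/\gamma$ for all $e\in C$, and an \emph{$\alpha$-decomposition} of $C$ is (the edge set of) a collection $P\subseteq C$ of vertex-disjoint paths with $w(P)\ge\alpha\, w(C)$. \textbf{Theorem.} There are a randomized algorithm and an absolute constant $K$ such that, for every $\varepsilon>0$, every $k\ge2$, every directed cycle cover $C$ and all non-negative weights $w=(w_1,\dots,w_k)$ for which $(C,w)$ is $1/\eta_{k,\varepsilon}$-light, the algorithm, on input $\varepsilon,k,C,w$, runs in expected time at most $K$ times the input size and outputs, whenever it halts (which it does with probability $1$), a $\bigl(\tfrac12-\varepsilon\bigr)$-decomposition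 of $C$. In the same sense, for undirected cycle covers $C$ there is a randomized algorithm with expected running time linear in the input size that always outputs a $\bigl(\tfrac23-\varepsilon\bigr)$-decomposition of $C$. Here algorithms are programs of a randomized random access machine on which each of the following takes one step: an addition, a (truncated) subtraction or a comparison of natural numbers, a direct or indirect memory access, drawing a uniformly distributed element of $\{0,\dots,a\}$ for a computed $a$, and an addition, subtraction, multiplication or comparison of weights (which are real numbers). The input consists of $k$, $n$, the number of cycles, the lengths of the cycles, the vertices of each cycle in cyclic order, $\varepsilon$, and the $k$ weights of every edge of $C$; the input size is the total number of these numbers. The output $P$ is given by its characteristic vector with respect to the edges of $C$. -/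

import Mathlib

open scoped ENNReal

noncomputable section

/-! ### Cycle covers, light pairs and decompositions

Directed and undirected graphs are treated together. An ordered pair of vertices is turned into
an edge by a map `f : Fin n × Fin n → E`; for directed graphs `E = Fin n × Fin n` and `f = id`, for
undirected graphs `E = Sym2 (Fin n)` and `f (u, v) = s(u, v)`. -/

/-- A cycle cover of the complete graph on the vertices `0, …, n - 1`: vertex-disjoint cycles, each
of length at least `r`, such that every vertex lies on one of them. A cycle is given by the list of
its vertices in cyclic order. (`r = 2` for directed graphs, `r = 3` for undirected graphs.) -/
structure CycleCover (r n : ℕ) where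
  cycles : List (List (Fin n))
  nodup : cycles.flatten.Nodup
  spanning : ∀ v : Fin n, v ∈ cycles.flatten
  length_ge : ∀ c ∈ cycles, r ≤ c.length

/-- A directed cycle cover of the complete directed graph (without loops) on `n` vertices. -/
abbrev DirectedCycleCover (n : ℕ) := CycleCover 2 n

/-- An undirected cycle cover of the complete undirected graph (without loops) on `n` vertices. -/
abbrev UndirectedCycleCover (n : ℕ) := CycleCover 3 n

/-- The pairs of consecutive vertices of the cycle `c`, including (last vertex, first vertex). -/
def cycleArcs {n : ℕ} (c : List (Fin n)) : List (Fin n × Fin n) := c.zip (c.rotate 1)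

/-- The pairs of consecutive vertices of the path `p`. -/
def pathArcs {n : ℕ} (p : List (Fin n)) : List (Fin n × Fin n) := p.zip p.tail

/-- A directed edge is an ordered pair. -/
def directedEdge {n : ℕ} (a : Fin n × Fin n) : Fin n × Fin n := a

/-- An undirected edge is an unordered pair. -/
def undirectedEdge {n : ℕ} (a : Fin n × Fin n) : Sym2 (Fin n) := s(a.1, a.2)

/-- The edges of a cycle cover, cycle by cycle, in cyclic order. -/
def CycleCover.edgeList {r n : ℕ} {E : Type} (f : Fin n × Fin n → E) (C : CycleCover r n) :
    List E :=
  (C.cycles.flatMap cycleArcs).map f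

/-- The set of edges of a cycle cover. -/
def CycleCover.edges {r n : ℕ} {E : Type} [DecidableEq E] (f : Fin n × Fin n → E)
    (C : CycleCover r n) : Finset E :=
  (C.edgeList f).toFinset

/-- `w_i(S)`, the weight of the edge set `S` with respect to the `i`-th objective. -/
def weight {E : Type} {k : ℕ} (w : Fin k → E → ℝ) (i : Fin k) (S : Finset E) : ℝ :=
  ∑ e ∈ S, w i e

/-- `(C, w)` is `γ`-light: `w(e) ≤ w(C) / γ` for all `e ∈ C`, in every objective. -/
def IsLight {E : Type} {k : ℕ} (γ : ℝ) (C : Finset E) (w : Fin k → E → ℝ) : Prop :=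
  ∀ e ∈ C, ∀ i, w i e ≤ weight w i C / γ

/-- `P` is the edge set of a collection of vertex-disjoint paths. -/
def IsPathCollection {n : ℕ} {E : Type} [DecidableEq E] (f : Fin n × Fin n → E)
    (P : Finset E) : Prop :=
  ∃ paths : List (List (Fin n)), paths.flatten.Nodup ∧
    P = ((paths.flatMap pathArcs).map f).toFinset

/-- `P` is an `α`-decomposition of `C`: a collection `P ⊆ C` of vertex-disjoint paths with
`w(P) ≥ α w(C)` in every objective. -/
def IsDecomposition {n k : ℕ} {E : Type} [DecidableEq E] (f : Fin n × Fin n → E) (α : ℝ)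
    (w : Fin k → E → ℝ) (C P : Finset E) : Prop :=
  P ⊆ C ∧ IsPathCollection f P ∧ ∀ i, α * weight w i C ≤ weight w i P

/-- `η_{k,ε} = ε² / (2 ln k)`. -/
def eta (k : ℕ) (ε : ℝ) : ℝ := ε ^ 2 / (2 * Real.log k)

/-! ### Randomized random access machines

The machine works on natural numbers (for counting and for addressing) and, separately, on weights.
Every instruction takes one step; weights can only be copied, added, subtracted, multiplied and
compared. -/

inductive Instr where
  /-- `reg d := c` -/
  | const (d c : ℕ)
  /-- `reg d := reg a + reg b` -/
  | add (d a b : ℕ)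
  /-- `reg d := reg a - reg b` (zero if `reg a < reg b`) -/
  | sub (d a b : ℕ)
  /-- `reg d := mem (reg a)` -/
  | load (d a : ℕ)
  /-- `mem (reg a) := reg b` -/
  | store (a b : ℕ)
  /-- `reg d :=` a uniformly distributed element of `{0, …, reg a}`, drawn independently of
  everything that happened before -/
  | rand (d a : ℕ)
  /-- `wreg d := c` -/
  | wconst (d c : ℕ)
  /-- `wreg d := wreg a + wreg b` -/
  | wadd (d a b : ℕ)
  /-- `wreg d := wreg a - wreg b` -/
  | wsub (d a b : ℕ)
  /-- `wreg d := wreg a * wreg b` -/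
  | wmul (d a b : ℕ)
  /-- `wreg d := wmem (reg a)` -/
  | wload (d a : ℕ)
  /-- `wmem (reg a) := wreg b` -/
  | wstore (a b : ℕ)
  /-- go to instruction number `l` -/
  | jump (l : ℕ)
  /-- go to instruction number `l` if `reg a < reg b` -/
  | jumpLt (a b l : ℕ)
  /-- go to instruction number `l` if `wreg a < wreg b` -/
  | wjumpLt (a b l : ℕ)

/-- A program is a finite list of instructions, numbered from `0`. -/
abbrev Program := List Instr

/-- Program counter, registers and memory cells of the machine. -/
structure MachineState where
  pc : ℕ
  reg : ℕ → ℕ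
  mem : ℕ → ℕ
  wreg : ℕ → ℝ
  wmem : ℕ → ℝ

namespace MachineState

/-- Advance to the next instruction. -/
def next (s : MachineState) : MachineState := { s with pc := s.pc + 1 }

/-- Write `v` into register `d` and advance. -/
def setReg (s : MachineState) (d v : ℕ) : MachineState :=
  { s.next with reg := Function.update s.reg d v }

/-- Write `v` into memory cell `a` and advance. -/
def setMem (s : MachineState) (a v : ℕ) : MachineState :=
  { s.next with mem := Function.update s.mem a v }

/-- Write `x` into weight register `d` and advance. -/
def setWreg (s : MachineState) (d : ℕ) (x : ℝ) : MachineState :=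
  { s.next with wreg := Function.update s.wreg d x }

/-- Write `x` into weight memory cell `a` and advance. -/
def setWmem (s : MachineState) (a : ℕ) (x : ℝ) : MachineState :=
  { s.next with wmem := Function.update s.wmem a x }

/-- Go to instruction number `l`. -/
def goto (s : MachineState) (l : ℕ) : MachineState := { s with pc := l }

end MachineState

/-- The distribution of the state after the execution of one instruction. -/
def Instr.exec (s : MachineState) : Instr → PMF MachineState
  | .const d c => PMF.pure (s.setReg d c)
  | .add d a b => PMF.pure (s.setReg d (s.reg a + s.reg b))
  | .sub d a b => PMF.pure (s.setReg d (s.reg a - s.reg b))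
  | .load d a => PMF.pure (s.setReg d (s.mem (s.reg a)))
  | .store a b => PMF.pure (s.setMem (s.reg a) (s.reg b))
  | .rand d a => (PMF.uniformOfFintype (Fin (s.reg a + 1))).map fun x => s.setReg d x
  | .wconst d c => PMF.pure (s.setWreg d (c : ℝ))
  | .wadd d a b => PMF.pure (s.setWreg d (s.wreg a + s.wreg b))
  | .wsub d a b => PMF.pure (s.setWreg d (s.wreg a - s.wreg b))
  | .wmul d a b => PMF.pure (s.setWreg d (s.wreg a * s.wreg b))
  | .wload d a => PMF.pure (s.setWreg d (s.wmem (s.reg a)))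
  | .wstore a b => PMF.pure (s.setWmem (s.reg a) (s.wreg b))
  | .jump l => PMF.pure (s.goto l)
  | .jumpLt a b l => PMF.pure (if s.reg a < s.reg b then s.goto l else s.next)
  | .wjumpLt a b l => PMF.pure (if s.wreg a < s.wreg b then s.goto l else s.next)

namespace Program

/-- The machine halts when the program counter leaves the program. -/
def Halted (M : Program) (s : MachineState) : Prop := M.length ≤ s.pc

/-- One step of the machine; a halted machine does not change its state. -/
def step (M : Program) (s : MachineState) : PMF MachineState :=
  match M[s.pc]? with
  | none => PMF.pure s
  | some c => c.exec s

/-- The distribution of the state after `t` steps, started in the state `s`. -/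
def dist (M : Program) (s : MachineState) : ℕ → PMF MachineState
  | 0 => PMF.pure s
  | t + 1 => (M.dist s t).bind M.step

/-- The expected number `𝔼[T]` of steps until the machine halts (`T = ∞` if it never does), written
as `∑ₜ ℙ(T > t)`; since halted states do not change any more, `T > t` means that the state after
`t` steps is not halted. -/
def expectedTime (M : Program) (s : MachineState) : ℝ≥0∞ :=
  ∑' t : ℕ, (M.dist s t).toOuterMeasure {s' | ¬ M.Halted s'}

end Program

/-! ### Input and output -/

/-- The natural numbers in the input: `k`, the number `n` of vertices, the number of cycles, the
lengths of the cycles, and the vertices, cycle by cycle in cyclic order. -/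
def inputWords {r n : ℕ} (k : ℕ) (C : CycleCover r n) : List ℕ :=
  [k, n, C.cycles.length] ++ C.cycles.map List.length ++ C.cycles.flatten.map (fun v => (v : ℕ))

/-- The weights in the input: `ε`, followed by `w_1(e), …, w_k(e)` for the edges `e` of `C`, in the
order of `C.edgeList`; so the edge that leads from the `j`-th listed vertex to its successor on its
cycle comes as the `j`-th. -/
def inputWeights {r n k : ℕ} {E : Type} (f : Fin n × Fin n → E) (ε : ℝ) (C : CycleCover r n)
    (w : Fin k → E → ℝ) : List ℝ :=
  ε :: (C.edgeList f).flatMap fun e => List.ofFn fun i => w i e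

/-- The initial state: the input is in the memory, everything else is zero. -/
def initState {r n k : ℕ} {E : Type} (f : Fin n × Fin n → E) (ε : ℝ) (C : CycleCover r n)
    (w : Fin k → E → ℝ) : MachineState where
  pc := 0
  reg := fun _ => 0
  mem := fun j => (inputWords k C).getD j 0
  wreg := fun _ => 0
  wmem := fun j => (inputWeights f ε C w).getD j 0

/-- The size of the input: the total number of natural numbers and weights it consists of. -/
def inputSize {r n k : ℕ} {E : Type} (f : Fin n × Fin n → E) (ε : ℝ) (C : CycleCover r n)
    (w : Fin k → E → ℝ) : ℕ :=
  (inputWords k C).length + (inputWeights f ε C w).length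

/-- The set of edges of `C` that is the output in state `s`, given by its characteristic vector,
which starts in the memory cell to which register `0` points: the `j`-th edge of `C` is in the
output iff the `j`-th entry is nonzero. -/
def outputEdges {r n : ℕ} {E : Type} [DecidableEq E] (f : Fin n × Fin n → E) (C : CycleCover r n)
    (s : MachineState) : Finset E :=
  (Finset.univ.filter fun j : Fin (C.edgeList f).length =>
    s.mem (s.reg 0 + j) ≠ 0).image (C.edgeList f).get

/-- On input `(ε, C, w)`, the randomized program `M` computes an `α`-decomposition of `C` without
any error (whenever it halts, its output is an `α`-decomposition), and its expected running time is
at most `K` times the input size (so it halts with probability one). -/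
def LasVegasDecomposes {r n k : ℕ} {E : Type} [DecidableEq E] (M : Program) (K : ℕ)
    (f : Fin n × Fin n → E) (α ε : ℝ) (C : CycleCover r n) (w : Fin k → E → ℝ) : Prop :=
  (∀ t, ∀ s ∈ (M.dist (initState f ε C w) t).support, M.Halted s →
      IsDecomposition f α w (C.edges f) (outputEdges f C s)) ∧
    M.expectedTime (initState f ε C w) ≤ ((K * inputSize f ε C w : ℕ) : ℝ≥0∞)

end

/-!
The algorithm works in rounds. A round deletes one uniformly distributed edge from each cycle, so
that paths remain, and tests for each objective `i` whether the deleted edges weigh at most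
`(1 / r + ε) * w_i(C)`, where `r` is the smallest admissible length of a cycle (`r = 2` for directed
and `r = 3` for undirected graphs). It outputs the remaining edges if all tests succeed, and starts
another round otherwise. Hence an output is always a `(1 - 1 / r - ε)`-decomposition.

A cycle of length at least `r` loses at most the fraction `1 / r` of its weight in expectation. The
losses of the cycles are independent, and by lightness none exceeds `M = η * w_i(C)`. The loss of
a cycle `c` lies between `0` and its heaviest edge, whose squared weight is at most `M * w_i(c)`, so
Hoeffding's lemma (`sum_exp_div_le`) can be multiplied over the cycles (`avgChoice_exp_le`); the
`i`-th test fails with probability at most `exp (-2 * ε ^ 2 / η) = k⁻⁴` (`avgChoice_indicator_le`).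
A union bound shows that a round fails with probability at most `1 / 2` (`avgChoice_fails_le`).

The time of a round is linear in the input size, and the expected number of rounds is at most `2`.
To treat time and correctness at once, `Program.delay` counts the time points, up to a horizon `N`,
at which the machine has not halted with a correct output. As a function `g` of the state it obeys
`g s ≤ 1 + 𝔼 g (next state)` (`Program.StepBounded`), and this is all that the analysis of the
program `decomposer` uses: it bounds `g` at the beginning of a loop in terms of `g` at its end. The
bound for a round (`le_of_round`) contains `g` at the start of the next round;
`Program.delay_le_of_restart` solves this recursion, for which the horizon is needed, since `g` must
be finite. The bound is uniform in `N`, and a wrong output would contribute infinitely often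
(`Program.mem_of_halted_of_delay_le`), so it gives both the expected time and the correctness.

If there are no vertices, the weights, and with them the factor `k`, disappear from the input size.
The program then halts before the first round.
-/

open scoped ENNReal

/-! ### Expected time until success -/

namespace Program

/-- The expected number of the time points `0, …, N - 1` at which the machine, started in `s`, is
not in a state that belongs to `Q`. -/
noncomputable def delay (M : Program) (Q : Set MachineState) (N : ℕ) (s : MachineState) : ℝ≥0∞ :=
  ∑ t ∈ Finset.range N, (M.dist s t).toOuterMeasure Qᶜ

theorem step_of_halted {M : Program} {s : MachineState} (h : M.Halted s) :
    M.step s = PMF.pure s := by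
  have : M[s.pc]? = none := List.getElem?_eq_none h
  simp [step, this]

theorem dist_of_halted {M : Program} {s : MachineState} (h : M.Halted s) (t : ℕ) :
    M.dist s t = PMF.pure s := by
  induction t with
  | zero => rfl
  | succ t ih => rw [dist, ih, PMF.pure_bind, step_of_halted h]

theorem dist_succ' (M : Program) (s : MachineState) (t : ℕ) :
    M.dist s (t + 1) = (M.step s).bind fun s' => M.dist s' t := by
  induction t with
  | zero => simp [dist]
  | succ t ih =>
    rw [dist, ih, PMF.bind_bind]
    rfl

theorem toOuterMeasure_dist_le_one (M : Program) (s : MachineState) (t : ℕ)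
    (A : Set MachineState) : (M.dist s t).toOuterMeasure A ≤ 1 := by
  rw [PMF.toOuterMeasure_apply, ← (M.dist s t).tsum_coe]
  exact ENNReal.tsum_le_tsum fun x => Set.indicator_le_self _ _ x

theorem delay_le_natCast (M : Program) (Q : Set MachineState) (N : ℕ) (s : MachineState) :
    M.delay Q N s ≤ N := by
  calc M.delay Q N s ≤ ∑ _t ∈ Finset.range N, (1 : ℝ≥0∞) :=
        Finset.sum_le_sum fun t _ => toOuterMeasure_dist_le_one M s t _
    _ = N := by simp

/-- `g` decreases by at most one in expectation in each step of `M`. -/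
def StepBounded (M : Program) (g : MachineState → ℝ≥0∞) : Prop :=
  ∀ s, g s ≤ 1 + ∑' s', M.step s s' * g s'

/-- The horizon `N` may be kept fixed, although one step is spent, since `delay` is monotone in
`N`. -/
theorem stepBounded_delay (M : Program) (Q : Set MachineState) (N : ℕ) :
    M.StepBounded (M.delay Q N) := by
  intro s
  calc M.delay Q N s ≤ M.delay Q (N + 1) s :=
        Finset.sum_le_sum_of_subset (Finset.range_mono N.le_succ)
    _ = (M.dist s 0).toOuterMeasure Qᶜ
          + ∑ t ∈ Finset.range N, (M.dist s (t + 1)).toOuterMeasure Qᶜ := by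
        rw [delay, Finset.sum_range_succ', add_comm]
    _ ≤ 1 + ∑ t ∈ Finset.range N, (M.dist s (t + 1)).toOuterMeasure Qᶜ :=
        add_le_add_left (toOuterMeasure_dist_le_one M s 0 _) _
    _ = 1 + ∑' s', M.step s s' * M.delay Q N s' := by
        simp_rw [dist_succ', PMF.toOuterMeasure_bind_apply, delay, Finset.mul_sum]
        rw [Summable.tsum_finsetSum fun _ _ => ENNReal.summable]

theorem delay_eq_zero {M : Program} {Q : Set MachineState} {s : MachineState}
    (hQ : s ∈ Q) (hs : M.Halted s) (N : ℕ) : M.delay Q N s = 0 := by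
  refine Finset.sum_eq_zero fun t _ => ?_
  rw [dist_of_halted hs, PMF.toOuterMeasure_pure_apply, if_neg (by simpa using hQ)]

theorem expectedTime_le_of_delay_le {M : Program} {Q : Set MachineState} {s : MachineState}
    {B : ℝ≥0∞} (hQ : ∀ s ∈ Q, M.Halted s) (h : ∀ N, M.delay Q N s ≤ B) :
    M.expectedTime s ≤ B := by
  rw [expectedTime, ENNReal.tsum_eq_iSup_nat]
  refine iSup_le fun N => le_trans (Finset.sum_le_sum fun t _ => ?_) (h N)
  exact MeasureTheory.measure_mono fun s' hs' hQ' => hs' (hQ s' hQ')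

/-- Halting outside `Q` counts as never finishing, so it is impossible if the expected time until
`Q` is reached is finite. -/
theorem mem_of_halted_of_delay_le {M : Program} {Q : Set MachineState} {s s' : MachineState}
    {B : ℝ≥0∞} (hB : B ≠ ∞) (h : ∀ N, M.delay Q N s ≤ B) {t : ℕ}
    (hs' : s' ∈ (M.dist s t).support) (hh : M.Halted s') : s' ∈ Q := by
  by_contra hQ
  -- The machine stays in the halted state `s'`, so the probability of `s'` never decreases.
  have mono : ∀ u, M.dist s t s' ≤ M.dist s (t + u) s' := by
    intro u
    induction u with
    | zero => rfl
    | succ u ih =>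
      refine ih.trans ?_
      rw [← add_assoc, dist, PMF.bind_apply]
      refine le_trans (by simp [step_of_halted hh]) (ENNReal.le_tsum s')
  have hpos : M.dist s t s' ≠ 0 := (PMF.mem_support_iff _ _).1 hs'
  have lower : ∀ u, M.dist s t s' ≤ (M.dist s (u + t)).toOuterMeasure Qᶜ := by
    intro u
    rw [PMF.toOuterMeasure_apply, add_comm]
    refine (mono u).trans (le_trans ?_ (ENNReal.le_tsum s'))
    rw [Set.indicator_of_mem (by simpa using hQ)]
  have htop : (∑' u, (M.dist s u).toOuterMeasure Qᶜ) ≠ ∞ := by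
    refine ne_top_of_le_ne_top hB ?_
    rw [ENNReal.tsum_eq_iSup_nat]
    exact iSup_le h
  have hlim := (Filter.tendsto_add_atTop_iff_nat t).2
    (ENNReal.tendsto_atTop_zero_of_tsum_ne_top htop)
  exact hpos (le_zero_iff.1 (ge_of_tendsto' hlim lower))

/-- If a round started in `S` takes expected time at most `T` and leads back to `S` with probability
at most `1/2`, then the expected total time is at most `2 T`. -/
theorem delay_le_of_restart {M : Program} {Q S : Set MachineState} {N : ℕ} {T p : ℝ≥0∞}
    (hp : p ≤ 1 / 2)
    (h : ∀ a, (∀ s ∈ S, M.delay Q N s ≤ a) → ∀ s ∈ S, M.delay Q N s ≤ T + a * p) :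
    ∀ s ∈ S, M.delay Q N s ≤ 2 * T := by
  set a := ⨆ s ∈ S, M.delay Q N s with ha
  have hle : ∀ s ∈ S, M.delay Q N s ≤ a := fun s hs => le_iSup₂_of_le s hs le_rfl
  have htop : a / 2 ≠ ∞ := by
    refine (ENNReal.div_lt_top (ne_top_of_le_ne_top (ENNReal.natCast_ne_top N) ?_) (by simp)).ne
    exact iSup₂_le fun s _ => delay_le_natCast M Q N s
  have hrec : a ≤ T + a / 2 := by
    refine iSup₂_le fun s hs => (h a hle s hs).trans ?_
    rw [div_eq_mul_inv]
    gcongr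
    simpa using hp
  -- `a / 2` can be cancelled only because the horizon `N` makes `a` finite.
  have hhalf : a / 2 ≤ T := by
    have : a / 2 + a / 2 ≤ T + a / 2 := by rwa [ENNReal.add_halves]
    exact (ENNReal.add_le_add_iff_right htop).1 this
  intro s hs
  refine (hle s hs).trans ?_
  rw [← ENNReal.add_halves a, two_mul]
  exact add_le_add hhalf hhalf

end Program

/-! ### Deterministic and random blocks of instructions -/

/-- The state after the execution of one instruction, `none` for the random instruction.
Conditional jumps change only the program counter, so that the other components of a state reached
by a block of instructions can be read off without a case distinction. -/
noncomputable def Instr.detExec (s : MachineState) : Instr → Option MachineState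
  | .const d c => some (s.setReg d c)
  | .add d a b => some (s.setReg d (s.reg a + s.reg b))
  | .sub d a b => some (s.setReg d (s.reg a - s.reg b))
  | .load d a => some (s.setReg d (s.mem (s.reg a)))
  | .store a b => some (s.setMem (s.reg a) (s.reg b))
  | .rand _ _ => none
  | .wconst d c => some (s.setWreg d (c : ℝ))
  | .wadd d a b => some (s.setWreg d (s.wreg a + s.wreg b))
  | .wsub d a b => some (s.setWreg d (s.wreg a - s.wreg b))
  | .wmul d a b => some (s.setWreg d (s.wreg a * s.wreg b))
  | .wload d a => some (s.setWreg d (s.wmem (s.reg a)))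
  | .wstore a b => some (s.setWmem (s.reg a) (s.wreg b))
  | .jump l => some (s.goto l)
  | .jumpLt a b l => some { s with pc := if s.reg a < s.reg b then l else s.pc + 1 }
  | .wjumpLt a b l => some { s with pc := if s.wreg a < s.wreg b then l else s.pc + 1 }

theorem Instr.exec_of_detExec {s s' : MachineState} {c : Instr} (h : c.detExec s = some s') :
    c.exec s = PMF.pure s' := by
  cases c <;> simp only [Instr.detExec, Option.some.injEq, reduceCtorEq] at h <;> subst h <;>
    simp only [Instr.exec]
  all_goals split_ifs <;> rfl

namespace Program

/-- The state after `c` steps; `none` if the machine halts before or meets a random instruction. -/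
noncomputable def run (M : Program) : ℕ → MachineState → Option MachineState
  | 0, s => some s
  | c + 1, s => (M[s.pc]?.bind (Instr.detExec s)).bind (M.run c)

variable {M : Program} {g : MachineState → ℝ≥0∞}

theorem StepBounded.le_of_run (hg : M.StepBounded g) {c : ℕ} {s s' : MachineState}
    (h : M.run c s = some s') : g s ≤ c + g s' := by
  induction c generalizing s with
  | zero => simp [run] at h; simp [h]
  | succ c ih =>
    obtain ⟨s₁, h₁, h₂⟩ := Option.bind_eq_some_iff.1 h
    obtain ⟨i, hi, h₁⟩ := Option.bind_eq_some_iff.1 h₁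
    have hstep : M.step s = PMF.pure s₁ := by
      simp [step, hi, Instr.exec_of_detExec h₁]
    have := hg s
    rw [hstep, tsum_eq_single s₁ (by intro b hb; simp [PMF.pure_apply_of_ne _ _ hb])] at this
    simp only [PMF.pure_apply_self, one_mul] at this
    refine this.trans ?_
    rw [Nat.cast_succ, add_comm (c : ℝ≥0∞), add_assoc]
    gcongr
    exact ih h₂

/-- A random instruction replaces `g s` by the average over the `L` equally likely outcomes. -/
theorem StepBounded.le_of_rand (hg : M.StepBounded g) {s : MachineState} {d a L : ℕ}
    (h : M[s.pc]? = some (.rand d a)) (hL : s.reg a + 1 = L) :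
    g s ≤ 1 + (∑ x ∈ Finset.range L, g (s.setReg d x)) / L := by
  classical
  subst hL
  refine (hg s).trans_eq ?_
  have hstep : M.step s =
      (PMF.uniformOfFintype (Fin (s.reg a + 1))).map fun x : Fin (s.reg a + 1) =>
        s.setReg d (x : ℕ) := by
    simp only [step, h, Instr.exec]
    -- The definition of `Instr.exec` first maps the outcome to a natural number.
    change PMF.map _ (PMF.bind _ fun x : Fin (s.reg a + 1) => PMF.pure (x : ℕ)) = _
    rw [PMF.map_bind]
    simp_rw [PMF.pure_map]
    rfl
  -- The probability of a state is a sum over the outcomes that lead to it; then the sums over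
  -- states and outcomes are interchanged.
  have key : ∀ s', M.step s s' * g s' = ∑ x : Fin (s.reg a + 1),
      if s' = s.setReg d x then ((s.reg a + 1 : ℕ) : ℝ≥0∞)⁻¹ * g s' else 0 := by
    intro s'
    rw [hstep, PMF.map_apply, tsum_fintype, Finset.sum_mul]
    refine Finset.sum_congr rfl fun x _ => ?_
    split_ifs <;> simp
  simp_rw [key]
  rw [Summable.tsum_finsetSum fun _ _ => ENNReal.summable, ENNReal.div_eq_inv_mul,
    Finset.mul_sum, Finset.sum_range]
  congr 1
  exact Finset.sum_congr rfl fun x _ => tsum_ite_eq _ _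

end Program

theorem Program.StepBounded.le_of_run_of_le {M : Program} {g : MachineState → ℝ≥0∞}
    (hg : M.StepBounded g) {c c' C : ℕ} {s s' : MachineState} {b : ℝ≥0∞}
    (h : M.run c s = some s') (h' : g s' ≤ c' + b) (hC : c + c' = C) : g s ≤ C + b := by
  refine (hg.le_of_run h).trans ?_
  rw [← hC, Nat.cast_add, add_assoc]
  gcongr

/-! ### The program -/

/-- The program that repeatedly deletes one random edge from each cycle until the remaining edges
are heavy enough. Register `0` points to the characteristic vector of the remaining edges, which
overwrites the list of vertices in the input.

* `0 - 15`: setup; without vertices, halt at once.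
* `16 - 19`: mark all edges as kept.
* `20 - 29`: for each cycle, draw an edge and mark it as deleted.
* `30 - 47`: for each objective, sum up the weight `W` of all edges (in weight register `2`) and the
  weight `R` of the deleted ones (in weight register `3`); restart at `16` if
  `(ε * r + 1) * W < r * R`. -/
def decomposer (r : ℕ) : Program :=
  [ .const 1 1, .load 2 10, .load 3 1, .const 15 2, .load 0 15, .const 15 3, .add 0 0 15,
    .add 3 0 3, .add 12 2 1, .wconst 1 r, .wload 0 10, .wmul 0 0 1, .wconst 2 1, .wadd 0 0 2,
    .jumpLt 0 3 16, .jump 48,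
    .add 4 0 10,
    .store 4 1, .add 4 4 1, .jumpLt 4 3 17,
    .add 4 0 10, .add 5 15 10,
    .load 6 5, .sub 7 6 1, .rand 8 7, .add 9 4 8, .store 9 10, .add 4 4 6, .add 5 5 1,
    .jumpLt 5 0 22,
    .add 11 1 10,
    .add 13 11 10, .add 4 0 10, .wadd 2 7 7, .wadd 3 7 7,
    .wload 4 13, .wadd 2 2 4, .load 14 4, .jumpLt 10 14 40, .wadd 3 3 4,
    .add 13 13 2, .add 4 4 1, .jumpLt 4 3 35,
    .wmul 5 0 2, .wmul 6 1 3, .wjumpLt 5 6 16, .add 11 11 1, .jumpLt 11 12 31 ]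

/-- The registers, the lengths of the cycles and the weights are as after the setup; `k`, `n` and
`m` are the numbers of objectives, of vertices and of cycles, and `mem₀` and `wmem₀` are the initial
memory. -/
structure Ready (r k n m : ℕ) (mem₀ : ℕ → ℕ) (wmem₀ : ℕ → ℝ) (s : MachineState) : Prop where
  reg_zero : s.reg 0 = 3 + m
  reg_one : s.reg 1 = 1
  reg_two : s.reg 2 = k
  reg_three : s.reg 3 = 3 + m + n
  reg_ten : s.reg 10 = 0
  reg_twelve : s.reg 12 = k + 1
  reg_fifteen : s.reg 15 = 3
  wreg_zero : s.wreg 0 = wmem₀ 0 * r + 1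
  wreg_one : s.wreg 1 = r
  wreg_seven : s.wreg 7 = 0
  mem_eq : ∀ j < 3 + m, s.mem j = mem₀ j
  wmem_eq : s.wmem = wmem₀

/-- The characteristic vector in the memory marks the edges in `D` as deleted and the others as
kept. -/
def Marks (n m : ℕ) (D : List ℕ) (s : MachineState) : Prop :=
  ∀ j < n, s.mem (3 + m + j) = if j ∈ D then 0 else 1

/-- The average of `b` over all choices of one index below each of the given lengths. -/
noncomputable def avgChoice : List ℕ → (List ℕ → ℝ≥0∞) → ℝ≥0∞
  | [], b => b []
  | L :: Ls, b => (∑ x ∈ Finset.range L, avgChoice Ls fun xs => b (x :: xs)) / L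

/-- The positions in the list of all edges of the chosen edges, for cycles whose edges are listed
from position `base` on. -/
def deletedFrom : ℕ → List ℕ → List ℕ → List ℕ
  | base, L :: Ls, x :: xs => (base + x) :: deletedFrom (base + L) Ls xs
  | _, _, _ => []

/-- The weight of the `j`-th edge in the `i`-th objective. -/
def cellWeight (k : ℕ) (wmem₀ : ℕ → ℝ) (i j : ℕ) : ℝ := wmem₀ (1 + i + j * k)

/-- The deletion of the edges in `D` fails the test for the `i`-th objective. -/
def Fails (r k n : ℕ) (wmem₀ : ℕ → ℝ) (D : List ℕ) (i : ℕ) : Prop :=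
  (wmem₀ 0 * r + 1) * ∑ j ∈ Finset.range n, cellWeight k wmem₀ i j
    < r * ∑ j ∈ Finset.range n, if j ∈ D then cellWeight k wmem₀ i j else 0

/-! ### Analysis of the blocks of the program -/

theorem run_setup (r : ℕ) (mem : ℕ → ℕ) (wmem : ℕ → ℝ) :
    ∃ s, (decomposer r).run 15 ⟨0, fun _ => 0, mem, fun _ => 0, wmem⟩ = some s ∧
      s.pc = (if mem 2 + 3 < mem 2 + 3 + mem 1 then 16 else 15) ∧ s.mem = mem ∧ s.wmem = wmem ∧
      s.reg 0 = mem 2 + 3 ∧ s.reg 1 = 1 ∧ s.reg 2 = mem 0 ∧ s.reg 3 = mem 2 + 3 + mem 1 ∧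
      s.reg 10 = 0 ∧ s.reg 12 = mem 0 + 1 ∧ s.reg 15 = 3 ∧
      s.wreg 0 = wmem 0 * (r : ℝ) + (1 : ℕ) ∧ s.wreg 1 = r ∧ s.wreg 7 = 0 :=
  ⟨_, rfl, rfl, rfl, rfl, rfl, rfl, rfl, rfl, rfl, rfl, rfl, rfl, rfl, rfl⟩

section
variable (r : ℕ) (reg mem : ℕ → ℕ) (wreg wmem : ℕ → ℝ)

theorem run_start : (decomposer r).run 1 ⟨16, reg, mem, wreg, wmem⟩ = some
    ⟨17, Function.update reg 4 (reg 0 + reg 10), mem, wreg, wmem⟩ := rfl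

theorem run_fill : (decomposer r).run 3 ⟨17, reg, mem, wreg, wmem⟩ = some
    ⟨if reg 4 + reg 1 < reg 3 then 17 else 20, Function.update reg 4 (reg 4 + reg 1),
      Function.update mem (reg 4) (reg 1), wreg, wmem⟩ := rfl

theorem run_startChoose : (decomposer r).run 2 ⟨20, reg, mem, wreg, wmem⟩ = some
    ⟨22, Function.update (Function.update reg 4 (reg 0 + reg 10)) 5 (reg 15 + reg 10),
      mem, wreg, wmem⟩ := rfl

theorem run_loadLength : (decomposer r).run 2 ⟨22, reg, mem, wreg, wmem⟩ = some
    ⟨24, Function.update (Function.update reg 6 (mem (reg 5))) 7 (mem (reg 5) - reg 1),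
      mem, wreg, wmem⟩ := rfl

theorem run_delete : (decomposer r).run 5 ⟨25, reg, mem, wreg, wmem⟩ = some
    ⟨if reg 5 + reg 1 < reg 0 then 22 else 30,
      Function.update (Function.update (Function.update reg 9 (reg 4 + reg 8)) 4 (reg 4 + reg 6))
        5 (reg 5 + reg 1),
      Function.update mem (reg 4 + reg 8) (reg 10), wreg, wmem⟩ := rfl

theorem run_startCheck : (decomposer r).run 1 ⟨30, reg, mem, wreg, wmem⟩ = some
    ⟨31, Function.update reg 11 (reg 1 + reg 10), mem, wreg, wmem⟩ := rfl

theorem run_startSum : (decomposer r).run 4 ⟨31, reg, mem, wreg, wmem⟩ = some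
    ⟨35, Function.update (Function.update reg 13 (reg 11 + reg 10)) 4 (reg 0 + reg 10), mem,
      Function.update (Function.update wreg 2 (wreg 7 + wreg 7)) 3 (wreg 7 + wreg 7), wmem⟩ := rfl

theorem run_addTotal : (decomposer r).run 4 ⟨35, reg, mem, wreg, wmem⟩ = some
    ⟨if reg 10 < mem (reg 4) then 40 else 39, Function.update reg 14 (mem (reg 4)), mem,
      Function.update (Function.update wreg 4 (wmem (reg 13))) 2 (wreg 2 + wmem (reg 13)),
      wmem⟩ := rfl

theorem run_addDeleted : (decomposer r).run 1 ⟨39, reg, mem, wreg, wmem⟩ = some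
    ⟨40, reg, mem, Function.update wreg 3 (wreg 3 + wreg 4), wmem⟩ := rfl

theorem run_nextEdge : (decomposer r).run 3 ⟨40, reg, mem, wreg, wmem⟩ = some
    ⟨if reg 4 + reg 1 < reg 3 then 35 else 43,
      Function.update (Function.update reg 13 (reg 13 + reg 2)) 4 (reg 4 + reg 1), mem, wreg,
      wmem⟩ := rfl

theorem run_compare : (decomposer r).run 3 ⟨43, reg, mem, wreg, wmem⟩ = some
    ⟨if wreg 0 * wreg 2 < wreg 1 * wreg 3 then 16 else 46, reg, mem,
      Function.update (Function.update wreg 5 (wreg 0 * wreg 2)) 6 (wreg 1 * wreg 3), wmem⟩ := rfl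

theorem run_nextObjective : (decomposer r).run 2 ⟨46, reg, mem, wreg, wmem⟩ = some
    ⟨if reg 11 + reg 1 < reg 12 then 31 else 48, Function.update reg 11 (reg 11 + reg 1), mem, wreg,
      wmem⟩ := rfl
end

section
variable {r k n m : ℕ} {mem₀ : ℕ → ℕ} {wmem₀ : ℕ → ℝ} {g : MachineState → ℝ≥0∞}

/-- The loop that marks the edges `j, …, j + d` as kept. -/
theorem le_of_fill (hg : (decomposer r).StepBounded g) {b : ℝ≥0∞}
    (hb : ∀ s, s.pc = 20 → Ready r k n m mem₀ wmem₀ s → Marks n m [] s → g s ≤ b)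
    (d : ℕ) {j : ℕ} (hj : j + d + 1 = n) {s : MachineState} (hpc : s.pc = 17)
    (hs : Ready r k n m mem₀ wmem₀ s) (h4 : s.reg 4 = 3 + m + j)
    (hmem : ∀ i < j, s.mem (3 + m + i) = 1) :
    g s ≤ ((3 * (d + 1) : ℕ) : ℝ≥0∞) + b := by
  induction d generalizing j s with
  | zero =>
    obtain ⟨pc, reg, mem, wreg, wmem⟩ := s
    obtain rfl : pc = 17 := hpc
    obtain ⟨h0, h1, h2, h3, h10, h12, h15, hw0, hw1, hw7, hm, hw⟩ := hs
    simp only at *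
    refine hg.le_of_run_of_le (c' := 0) (run_fill ..) ?_ (by omega)
    rw [Nat.cast_zero, zero_add]
    apply hb
    · rw [h4, h1, h3]; simp; omega
    · constructor <;> simp [*]
      intro i hi
      rw [Function.update_of_ne (by omega), hm i hi]
    · intro i hi
      simp only [h4, h1, List.not_mem_nil, if_false, Function.update_apply]
      split_ifs
      · rfl
      · exact hmem i (by omega)
  | succ d ih =>
    obtain ⟨pc, reg, mem, wreg, wmem⟩ := s
    obtain rfl : pc = 17 := hpc
    obtain ⟨h0, h1, h2, h3, h10, h12, h15, hw0, hw1, hw7, hm, hw⟩ := hs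
    simp only at *
    refine hg.le_of_run_of_le (run_fill ..) (ih (j := j + 1) (by omega) ?_ ?_ ?_ ?_) (by omega)
    · rw [h4, h1, h3, if_pos (by omega)]
    · constructor <;> simp [*]
      intro i hi
      rw [Function.update_of_ne (by omega), hm i hi]
    · simp [*]; omega
    · intro i hi
      simp only [h4, h1, Function.update_apply]
      split_ifs
      · rfl
      · exact hmem i (by omega)

/-- The deletion of one edge from a cycle of length `L` whose edges are listed from position `base`
on. -/
theorem le_of_choose_step (hg : (decomposer r).StepBounded g) {L q base c : ℕ} {D : List ℕ}
    {b : ℕ → ℝ≥0∞} (hL : mem₀ (3 + q) = L) (hpos : 0 < L) (hq : q < m)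
    (hb : ∀ x < L, ∀ s, s.pc = (if q + 1 < m then 22 else 30) → Ready r k n m mem₀ wmem₀ s →
      Marks n m (D ++ [base + x]) s → s.reg 5 = 3 + (q + 1) → s.reg 4 = 3 + m + (base + L) →
      g s ≤ (c : ℝ≥0∞) + b x)
    {s : MachineState} (hpc : s.pc = 22)
    (hs : Ready r k n m mem₀ wmem₀ s) (h5 : s.reg 5 = 3 + q) (h4 : s.reg 4 = 3 + m + base)
    (hD : Marks n m D s) :
    g s ≤ ((8 + c : ℕ) : ℝ≥0∞) + (∑ x ∈ Finset.range L, b x) / L := by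
  obtain ⟨pc, reg, mem, wreg, wmem⟩ := s
  obtain rfl : pc = 22 := hpc
  obtain ⟨h0, h1, h2, h3, h10, h12, h15, hw0, hw1, hw7, hm, hw⟩ := hs
  simp only at *
  have hmL : mem (reg 5) = L := by rw [h5, hm _ (by omega), hL]
  refine hg.le_of_run_of_le (c' := 6 + c) (run_loadLength ..) ?_ (by omega)
  rw [hmL, h1]
  refine (hg.le_of_rand (d := 8) (a := 7) (L := L) rfl ?_).trans ?_
  · simp only [Function.update_self]
    omega
  have key : ∀ x ∈ Finset.range L, g ((⟨24, Function.update (Function.update reg 6 L) 7 (L - 1),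
      mem, wreg, wmem⟩ : MachineState).setReg 8 x) ≤ ((5 + c : ℕ) : ℝ≥0∞) + b x := by
    intro x hx
    refine hg.le_of_run_of_le (run_delete ..)
      (hb x (Finset.mem_range.1 hx) _ ?_ ?_ ?_ ?_ ?_) rfl
    · simp only [ne_eq, Nat.reduceEqDiff,
        not_false_eq_true, Function.update_of_ne, h5, h1, h0]
      congr 1
      simp only [eq_iff_iff]
      omega
    · constructor <;> simp [MachineState.next, *]
      intro i hi
      rw [Function.update_of_ne (by omega), hm i hi]
    · intro i hi
      have := hD i hi
      simp only [MachineState.next, ne_eq, Nat.reduceEqDiff,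
        not_false_eq_true, Function.update_of_ne, Function.update_self, h4, h10,
        Function.update_apply, List.mem_append, List.mem_singleton] at this ⊢
      simp only [this, show (3 + m + i = 3 + m + base + x) ↔ i = base + x by omega]
      by_cases h : i = base + x <;> simp [h]
    · simp [h5, h1, add_assoc]
    · simp [h4, add_assoc]
  calc 1 + (∑ x ∈ Finset.range L, g ((⟨24, Function.update (Function.update reg 6 L) 7 (L - 1),
        mem, wreg, wmem⟩ : MachineState).setReg 8 x)) / L
      ≤ 1 + (∑ x ∈ Finset.range L, (((5 + c : ℕ) : ℝ≥0∞) + b x)) / L := by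
        gcongr with x hx
        exact key x hx
    _ = ((6 + c : ℕ) : ℝ≥0∞) + (∑ x ∈ Finset.range L, b x) / L := by
        rw [Finset.sum_add_distrib, ENNReal.add_div, Finset.sum_const, Finset.card_range,
          nsmul_eq_mul, mul_comm, ENNReal.mul_div_cancel_right (by exact_mod_cast hpos.ne')
          (ENNReal.natCast_ne_top L), ← add_assoc]
        congr 1
        push_cast
        rw [← add_assoc]
        congr 1
        norm_num

/-- The loop over the cycles, entered before a cycle of length `L`; the following cycles have the
lengths `Ls`. -/
theorem le_of_choose (hg : (decomposer r).StepBounded g) (Ls : List ℕ) {L q base : ℕ} {D : List ℕ}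
    {b : List ℕ → ℝ≥0∞}
    (hb : ∀ xs, List.Forall₂ (· < ·) xs (L :: Ls) → ∀ s, s.pc = 30 → Ready r k n m mem₀ wmem₀ s →
      Marks n m (D ++ deletedFrom base (L :: Ls) xs) s → g s ≤ b xs)
    (hlen : ∀ j (hj : j < (L :: Ls).length), mem₀ (3 + q + j) = (L :: Ls)[j])
    (hq : q + (L :: Ls).length = m) (hpos : ∀ l ∈ L :: Ls, 0 < l)
    {s : MachineState} (hpc : s.pc = 22)
    (hs : Ready r k n m mem₀ wmem₀ s) (h5 : s.reg 5 = 3 + q) (h4 : s.reg 4 = 3 + m + base)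
    (hD : Marks n m D s) :
    g s ≤ ((8 * (L :: Ls).length : ℕ) : ℝ≥0∞) + avgChoice (L :: Ls) b := by
  induction Ls generalizing L q base D b s with
  | nil =>
    simp only [List.length_singleton] at hq
    refine le_of_choose_step hg (c := 0) (by simpa using hlen 0) (hpos L (by simp)) (by omega)
      ?_ hpc hs h5 h4 hD
    intro x hx s' hpc' hs' hD' _ _
    rw [if_neg (by omega)] at hpc'
    rw [Nat.cast_zero, zero_add]
    exact hb [x] (.cons hx .nil) s' hpc' hs' hD'
  | cons L' Ls ih =>
    simp only [List.length_cons] at hq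
    have := le_of_choose_step hg (c := 8 * (L' :: Ls).length)
      (b := fun x => avgChoice (L' :: Ls) fun xs => b (x :: xs))
      (by simpa using hlen 0) (hpos L (by simp)) (by omega)
      (fun x hx s' hpc' hs' hD' h5' h4' => ?_) hpc hs h5 h4 hD
    · refine this.trans_eq ?_
      rw [show 8 + 8 * (L' :: Ls).length = 8 * (L :: L' :: Ls).length by
        simp only [List.length_cons]; ring]
      rfl
    · rw [if_pos (by omega)] at hpc'
      refine ih ?_ ?_ (by simp only [List.length_cons]; omega)
        (fun l hl => hpos l (List.mem_cons_of_mem _ hl)) hpc' hs' h5' h4' hD'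
      · intro xs hxs s'' hpc'' hs'' hD''
        refine hb (x :: xs) (.cons hx hxs) s'' hpc'' hs'' ?_
        simpa [deletedFrom] using hD''
      · intro j hj
        have := hlen (j + 1) (by simpa using hj)
        rw [show 3 + (q + 1) + j = 3 + q + (j + 1) by omega, this]
        rfl

/-- The body of the loop that sums up the weights in the `i`-th objective, for the `j`-th edge. -/
theorem le_of_sum_step (hg : (decomposer r).StepBounded g) {b : ℝ≥0∞} {D : List ℕ} {i c j : ℕ}
    (hj : j < n)
    (hb : ∀ s, s.pc = (if j + 1 < n then 35 else 43) → Ready r k n m mem₀ wmem₀ s →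
      Marks n m D s → s.reg 11 = 1 + i →
      s.reg 4 = 3 + m + (j + 1) → s.reg 13 = 1 + i + (j + 1) * k →
      s.wreg 2 = ∑ j ∈ Finset.range (j + 1), cellWeight k wmem₀ i j →
      s.wreg 3 = (∑ j ∈ Finset.range (j + 1), if j ∈ D then cellWeight k wmem₀ i j else 0) →
      g s ≤ c + b)
    {s : MachineState} (hpc : s.pc = 35)
    (hs : Ready r k n m mem₀ wmem₀ s) (hD : Marks n m D s) (h11 : s.reg 11 = 1 + i)
    (h4 : s.reg 4 = 3 + m + j) (h13 : s.reg 13 = 1 + i + j * k)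
    (hw2 : s.wreg 2 = ∑ j ∈ Finset.range j, cellWeight k wmem₀ i j)
    (hw3 : s.wreg 3 = ∑ j ∈ Finset.range j, if j ∈ D then cellWeight k wmem₀ i j else 0) :
    g s ≤ ((8 + c : ℕ) : ℝ≥0∞) + b := by
  obtain ⟨pc, reg, mem, wreg, wmem⟩ := s
  obtain rfl : pc = 35 := hpc
  obtain ⟨h0, h1, h2, h3, h10, h12, h15, hw0, hw1, hw7, hm, hw⟩ := hs
  simp only at *
  have hv := hD j hj
  simp only at hv
  refine hg.le_of_run_of_le (c' := 4 + c) (run_addTotal ..) ?_ (by omega)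
  rw [h10, h4, hv]
  by_cases hjD : j ∈ D
  · simp only [hjD, if_true, lt_irrefl, if_false]
    refine hg.le_of_run_of_le (c' := 3 + c) (run_addDeleted ..) ?_ (by omega)
    refine hg.le_of_run_of_le (run_nextEdge ..) (hb _ ?_ ?_ ?_ ?_ ?_ ?_ ?_ ?_) rfl
    · simp [*, add_assoc]
    · constructor <;> simp [*]
      exact hm
    · exact hD
    · simp [*]
    · simp [*, add_assoc]
    · simp [*]; ring
    · simp [*, Finset.sum_range_succ, cellWeight]
    · simp [*, Finset.sum_range_succ, cellWeight]
  · simp only [hjD, if_false, zero_lt_one, if_true]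
    refine (hg.le_of_run_of_le (c' := c) (C := 3 + c) (b := b) (run_nextEdge ..)
      (hb _ ?_ ?_ ?_ ?_ ?_ ?_ ?_ ?_) rfl).trans ?_
    · simp [*, add_assoc]
    · constructor <;> simp [*]
      exact hm
    · exact hD
    · simp [*]
    · simp [*, add_assoc]
    · simp [*]; ring
    · simp [*, Finset.sum_range_succ, cellWeight]
    · simp [*, Finset.sum_range_succ]
    -- A kept edge takes one step less than a deleted one.
    · gcongr
      norm_num

/-- The loop that sums up the weights of the edges `j, …, j + d` in the `i`-th objective. -/
theorem le_of_sum (hg : (decomposer r).StepBounded g) {b : ℝ≥0∞} {D : List ℕ} {i : ℕ}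
    (hb : ∀ s, s.pc = 43 → Ready r k n m mem₀ wmem₀ s → Marks n m D s → s.reg 11 = 1 + i →
      s.wreg 2 = ∑ j ∈ Finset.range n, cellWeight k wmem₀ i j →
      s.wreg 3 = (∑ j ∈ Finset.range n, if j ∈ D then cellWeight k wmem₀ i j else 0) → g s ≤ b)
    (d : ℕ) {j : ℕ} (hj : j + d + 1 = n) {s : MachineState} (hpc : s.pc = 35)
    (hs : Ready r k n m mem₀ wmem₀ s) (hD : Marks n m D s) (h11 : s.reg 11 = 1 + i)
    (h4 : s.reg 4 = 3 + m + j) (h13 : s.reg 13 = 1 + i + j * k)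
    (hw2 : s.wreg 2 = ∑ j ∈ Finset.range j, cellWeight k wmem₀ i j)
    (hw3 : s.wreg 3 = ∑ j ∈ Finset.range j, if j ∈ D then cellWeight k wmem₀ i j else 0) :
    g s ≤ ((8 * (d + 1) : ℕ) : ℝ≥0∞) + b := by
  induction d generalizing j s with
  | zero =>
    refine le_of_sum_step hg (c := 0) (by omega) ?_ hpc hs hD h11 h4 h13 hw2 hw3
    intro s' hpc' hs' hD' h11' _ _ hw2' hw3'
    obtain rfl : n = j + 1 := by omega
    rw [Nat.cast_zero, zero_add]
    exact hb s' (by simpa using hpc') hs' hD' h11' hw2' hw3'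
  | succ d ih =>
    rw [show 8 * (d + 1 + 1) = 8 + 8 * (d + 1) by ring]
    refine le_of_sum_step hg (by omega) ?_ hpc hs hD h11 h4 h13 hw2 hw3
    intro s' hpc' hs' hD' h11' h4' h13' hw2' hw3'
    rw [if_pos (by omega)] at hpc'
    exact ih (by omega) hpc' hs' hD' h11' h4' h13' hw2' hw3'

/-- The test for the `i`-th objective. -/
theorem le_of_check_step (hg : (decomposer r).StepBounded g) (hn : 0 < n) {b : ℝ≥0∞} {D : List ℕ}
    {i c : ℕ} (hi : i < k)
    (hfail : Fails r k n wmem₀ D i → ∀ s, s.pc = 16 → Ready r k n m mem₀ wmem₀ s → g s ≤ b)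
    (hok : ¬ Fails r k n wmem₀ D i → ∀ s, s.pc = (if i + 1 < k then 31 else 48) →
      Ready r k n m mem₀ wmem₀ s → Marks n m D s → s.reg 11 = 1 + (i + 1) → g s ≤ c + b)
    {s : MachineState} (hpc : s.pc = 31)
    (hs : Ready r k n m mem₀ wmem₀ s) (hD : Marks n m D s) (h11 : s.reg 11 = 1 + i) :
    g s ≤ ((9 + 8 * n + c : ℕ) : ℝ≥0∞) + b := by
  obtain ⟨pc, reg, mem, wreg, wmem⟩ := s
  obtain rfl : pc = 31 := hpc
  obtain ⟨h0, h1, h2, h3, h10, h12, h15, hw0, hw1, hw7, hm, hw⟩ := hs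
  simp only at *
  refine hg.le_of_run_of_le (c' := 8 * n + (5 + c)) (run_startSum ..) ?_ (by omega)
  rw [Nat.cast_add, add_assoc]
  have hd : n - 1 + 1 = n := by omega
  have := le_of_sum (r := r) (k := k) (n := n) (m := m) (mem₀ := mem₀) (wmem₀ := wmem₀) hg
    (b := ((5 + c : ℕ) : ℝ≥0∞) + b) (D := D) (i := i) ?_ (n - 1) (j := 0) (by omega) rfl
    (s := ⟨35, Function.update (Function.update reg 13 (reg 11 + reg 10)) 4 (reg 0 + reg 10), mem,
      Function.update (Function.update wreg 2 (wreg 7 + wreg 7)) 3 (wreg 7 + wreg 7), wmem⟩)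
    ?_ hD ?_ ?_ ?_ ?_ ?_
  · rwa [hd] at this
  · rintro ⟨pc, reg, mem, wreg, wmem⟩ hpc hs hD h11 hw2 hw3
    obtain rfl : pc = 43 := hpc
    obtain ⟨h0, h1, h2, h3, h10, h12, h15, hw0, hw1, hw7, hm, hw⟩ := hs
    simp only at *
    have hready : ∀ pc, Ready r k n m mem₀ wmem₀ ⟨pc, reg, mem,
        Function.update (Function.update wreg 5 (wreg 0 * wreg 2)) 6 (wreg 1 * wreg 3),
        wmem⟩ := by
      intro pc
      constructor <;> simp [*]
      exact hm
    have hcond : wreg 0 * wreg 2 < wreg 1 * wreg 3 ↔ Fails r k n wmem₀ D i := by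
      rw [hw0, hw1, hw2, hw3, Fails]
    refine hg.le_of_run_of_le (c' := 2 + c) (run_compare ..) ?_ (by omega)
    by_cases hF : Fails r k n wmem₀ D i
    · rw [if_pos (hcond.2 hF)]
      exact (hfail hF _ rfl (hready 16)).trans le_add_self
    · rw [if_neg (mt hcond.1 hF)]
      refine hg.le_of_run_of_le (run_nextObjective ..) (hok hF _ ?_ ?_ hD ?_) rfl
      · simp only [h11, h1, h12]
        congr 1
        simp only [eq_iff_iff]
        omega
      · obtain ⟨h0, h1, h2, h3, h10, h12, h15, hw0, hw1, hw7, hm, hw⟩ := hready 46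
        simp only at *
        constructor <;> simp only [ne_eq, Nat.reduceEqDiff, not_false_eq_true,
          Function.update_of_ne] at * <;> assumption
      · simp [h11, h1, add_assoc]
  · constructor <;> simp [*]
    exact hm
  all_goals simp [*]

/-- The test started with objective `i`: if some objective fails, the program returns to the start
of a round, where `g` is at most `a`. -/
theorem le_of_check (hg : (decomposer r).StepBounded g) (hn : 0 < n) {a : ℝ≥0∞} {D : List ℕ}
    (ha : ∀ s, s.pc = 16 → Ready r k n m mem₀ wmem₀ s → g s ≤ a)
    (hgood : ∀ s, s.pc = 48 → Ready r k n m mem₀ wmem₀ s → Marks n m D s →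
      (∀ i < k, ¬ Fails r k n wmem₀ D i) → g s = 0)
    (d : ℕ) {i : ℕ} (hi : i + d + 1 = k) (hok : ∀ i' < i, ¬ Fails r k n wmem₀ D i')
    {s : MachineState} (hpc : s.pc = 31)
    (hs : Ready r k n m mem₀ wmem₀ s) (hD : Marks n m D s) (h11 : s.reg 11 = 1 + i) :
    g s ≤ (((9 + 8 * n) * (d + 1) : ℕ) : ℝ≥0∞) +
      a * {D | ∃ i < k, Fails r k n wmem₀ D i}.indicator 1 D := by
  have hfail : ∀ i < k, Fails r k n wmem₀ D i → ∀ s, s.pc = 16 → Ready r k n m mem₀ wmem₀ s →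
      g s ≤ a * {D | ∃ i < k, Fails r k n wmem₀ D i}.indicator 1 D := by
    intro i hi hF s hpc hs
    rw [Set.indicator_of_mem (by exact ⟨i, hi, hF⟩), Pi.one_apply, mul_one]
    exact ha s hpc hs
  have hok' : ∀ {i}, (∀ i' < i, ¬ Fails r k n wmem₀ D i') → ¬ Fails r k n wmem₀ D i →
      ∀ i' < i + 1, ¬ Fails r k n wmem₀ D i' := by
    intro i h1 h2 i' hi'
    obtain h | rfl := Nat.lt_succ_iff_lt_or_eq.1 hi'
    exacts [h1 i' h, h2]
  induction d generalizing i s with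
  | zero =>
    rw [show (9 + 8 * n) * (0 + 1) = 9 + 8 * n + 0 by ring]
    refine le_of_check_step hg hn (c := 0) (by omega) (hfail i (by omega)) ?_ hpc hs hD h11
    intro hF s' hpc' hs' hD' _
    obtain rfl : k = i + 1 := by omega
    rw [hgood s' (by simpa using hpc') hs' hD' (hok' hok hF)]
    exact zero_le
  | succ d ih =>
    rw [show (9 + 8 * n) * (d + 1 + 1) = 9 + 8 * n + (9 + 8 * n) * (d + 1) by ring]
    refine le_of_check_step hg hn (by omega) (hfail i (by omega)) ?_ hpc hs hD h11
    intro hF s' hpc' hs' hD' h11'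
    rw [if_pos (by omega)] at hpc'
    exact ih (by omega) (hok' hok hF) hpc' hs' hD' h11'
end

/-! ### Random choices and Hoeffding's inequality -/

theorem indicator_one_le {α : Type*} {A : Set α} {x : α} {c : ℝ≥0∞} (h : x ∈ A → 1 ≤ c) :
    A.indicator 1 x ≤ c := by
  by_cases hx : x ∈ A
  · simpa [hx] using h hx
  · simp [hx]

theorem avgChoice_mono {Ls : List ℕ} {b b' : List ℕ → ℝ≥0∞}
    (h : ∀ xs, List.Forall₂ (· < ·) xs Ls → b xs ≤ b' xs) : avgChoice Ls b ≤ avgChoice Ls b' := by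
  induction Ls generalizing b b' with
  | nil => exact h [] .nil
  | cons L Ls ih =>
    unfold avgChoice
    gcongr with x hx
    exact ih fun xs hxs => h _ (.cons (Finset.mem_range.1 hx) hxs)

theorem avgChoice_add (Ls : List ℕ) (b b' : List ℕ → ℝ≥0∞) :
    avgChoice Ls (fun xs => b xs + b' xs) = avgChoice Ls b + avgChoice Ls b' := by
  induction Ls generalizing b b' with
  | nil => rfl
  | cons L Ls ih => simp only [avgChoice, ih, Finset.sum_add_distrib, ENNReal.add_div]

theorem avgChoice_const_mul (Ls : List ℕ) (c : ℝ≥0∞) (b : List ℕ → ℝ≥0∞) :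
    avgChoice Ls (fun xs => c * b xs) = c * avgChoice Ls b := by
  induction Ls generalizing b with
  | nil => rfl
  | cons L Ls ih => simp only [avgChoice, ih, ← Finset.mul_sum, mul_div_assoc]

theorem avgChoice_const {Ls : List ℕ} (h : ∀ L ∈ Ls, 0 < L) (c : ℝ≥0∞) :
    avgChoice Ls (fun _ => c) = c := by
  induction Ls with
  | nil => rfl
  | cons L Ls ih =>
    have hL : (L : ℝ≥0∞) ≠ 0 := by exact_mod_cast (h L (by simp)).ne'
    simp only [avgChoice, ih fun l hl => h l (List.mem_cons_of_mem _ hl), Finset.sum_const,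
      Finset.card_range, nsmul_eq_mul]
    rw [mul_comm, ENNReal.mul_div_cancel_right hL (ENNReal.natCast_ne_top L)]

theorem avgChoice_sum {ι : Type*} (I : Finset ι) (Ls : List ℕ) (b : ι → List ℕ → ℝ≥0∞) :
    avgChoice Ls (fun xs => ∑ i ∈ I, b i xs) = ∑ i ∈ I, avgChoice Ls (b i) := by
  induction Ls generalizing b with
  | nil => rfl
  | cons L Ls ih =>
    simp only [avgChoice, ih, div_eq_mul_inv]
    rw [Finset.sum_comm, Finset.sum_mul]

theorem mem_deletedFrom {Ls xs : List ℕ} (h : List.Forall₂ (· < ·) xs Ls) {base j : ℕ}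
    (hj : j ∈ deletedFrom base Ls xs) : base ≤ j ∧ j < base + Ls.sum := by
  induction h generalizing base with
  | nil => simp [deletedFrom] at hj
  | @cons x L xs Ls hx _ ih =>
    rcases List.mem_cons.1 hj with rfl | hj
    · simp only [List.sum_cons]; omega
    · have := ih hj
      simp only [List.sum_cons]; omega

theorem nodup_deletedFrom {Ls xs : List ℕ} (h : List.Forall₂ (· < ·) xs Ls) (base : ℕ) :
    (deletedFrom base Ls xs).Nodup := by
  induction h generalizing base with
  | nil => simp [deletedFrom]
  | @cons x L xs Ls hx hxs ih =>
    refine List.nodup_cons.2 ⟨fun hmem => ?_, ih _⟩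
    have := (mem_deletedFrom hxs hmem).1
    omega

theorem sum_ite_mem_deletedFrom {Ls xs : List ℕ} (h : List.Forall₂ (· < ·) xs Ls) (v : ℕ → ℝ) :
    (∑ j ∈ Finset.range Ls.sum, if j ∈ deletedFrom 0 Ls xs then v j else 0)
      = ((deletedFrom 0 Ls xs).map v).sum := by
  rw [← List.sum_toFinset _ (nodup_deletedFrom h 0), ← Finset.sum_filter]
  refine Finset.sum_congr ?_ fun _ _ => rfl
  ext j
  simp only [Finset.mem_filter, Finset.mem_range, List.mem_toFinset, and_iff_right_iff_imp]
  intro hj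
  simpa using (mem_deletedFrom h hj).2

/-- Hoeffding's lemma for the weight of one random element of a family of total weight `∑ x, f x`
with at least `r` elements, none of which weighs more than `M`. -/
theorem sum_exp_div_le {r L : ℕ} (hr : 0 < r) (hL : r ≤ L) {f : ℕ → ℝ} {M t : ℝ} (ht : 0 ≤ t)
    (hf0 : ∀ x < L, 0 ≤ f x) (hfM : ∀ x < L, f x ≤ M) :
    (∑ x ∈ Finset.range L, Real.exp (t * f x)) / L
      ≤ Real.exp ((t / r + t ^ 2 * M / 8) * ∑ x ∈ Finset.range L, f x) := by
  have hL0 : 0 < L := hr.trans_le hL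
  obtain ⟨y, hy, hmax⟩ := Finset.exists_max_image (Finset.range L) f ⟨0, Finset.mem_range.2 hL0⟩
  simp only [Finset.mem_range] at hy hmax
  have : NeZero L := ⟨hL0.ne'⟩
  set S := ∑ x ∈ Finset.range L, f x with hS
  have hS0 : 0 ≤ S := Finset.sum_nonneg fun x hx => hf0 x (Finset.mem_range.1 hx)
  have hyS : f y ≤ S := Finset.single_le_sum (f := f)
    (fun x hx => hf0 x (Finset.mem_range.1 hx)) (Finset.mem_range.2 hy)
  let μ := (PMF.uniformOfFintype (Fin L)).toMeasure
  have hint : ∀ h : ℕ → ℝ, ∫ x : Fin L, h x ∂μ = (∑ x ∈ Finset.range L, h x) / L := by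
    intro h
    rw [PMF.integral_eq_sum, Finset.sum_range, Finset.sum_div]
    refine Finset.sum_congr rfl fun x _ => ?_
    simp [div_eq_inv_mul]
  have hsub := ProbabilityTheory.hasSubgaussianMGF_of_mem_Icc (μ := μ)
    (X := fun x : Fin L => f x) (a := 0) (b := f y) (measurable_of_finite _).aemeasurable
    (Filter.Eventually.of_forall fun x => ⟨hf0 x x.2, hmax x x.2⟩)
  have hmgf := hsub.mgf_le t
  rw [ProbabilityTheory.mgf] at hmgf
  have hE : ∫ x : Fin L, f x ∂μ = S / L := hint f
  rw [hE] at hmgf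
  have hsplit : ∫ x : Fin L, Real.exp (t * (f x - S / L)) ∂μ
      = (∑ x ∈ Finset.range L, Real.exp (t * f x)) / L * Real.exp (-(t * (S / L))) := by
    rw [hint fun x => Real.exp (t * (f x - S / L)), div_mul_eq_mul_div, Finset.sum_mul]
    congr 1
    refine Finset.sum_congr rfl fun x _ => ?_
    rw [← Real.exp_add]
    congr 1
    ring
  rw [hsplit, Real.exp_neg, ← div_eq_mul_inv, div_le_iff₀ (Real.exp_pos _), ← Real.exp_add]
    at hmgf
  refine hmgf.trans (Real.exp_le_exp.2 ?_)
  have h1 : t * (S / L) ≤ t / r * S := by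
    rw [div_mul_eq_mul_div, mul_div_assoc]
    have : (0 : ℝ) < r := by exact_mod_cast hr
    gcongr
  -- This makes the variance proxies of the cycles add up to at most `M` times the total weight.
  have h2 : f y ^ 2 ≤ M * S := by
    rw [sq]
    exact mul_le_mul (hfM y hy) hyS (hf0 y hy) ((hf0 y hy).trans (hfM y hy))
  have h3 : ((((‖f y - 0‖₊ / 2) ^ 2 : NNReal)) : ℝ) = f y ^ 2 / 4 := by
    simp [div_pow]
    norm_num
  rw [h3]
  nlinarith [mul_le_mul_of_nonneg_left h2 (sq_nonneg t)]

/-- Hoeffding's lemma for the deleted edges of all cycles: the choices are independent, so the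
bounds for the single cycles are multiplied. -/
theorem avgChoice_exp_le {r : ℕ} (hr : 0 < r) {v : ℕ → ℝ} {M t : ℝ} (ht : 0 ≤ t) {Ls : List ℕ}
    (hLs : ∀ L ∈ Ls, r ≤ L) {base : ℕ}
    (hv0 : ∀ j < base + Ls.sum, 0 ≤ v j) (hvM : ∀ j < base + Ls.sum, v j ≤ M) :
    avgChoice Ls (fun xs => .ofReal (Real.exp (t * ((deletedFrom base Ls xs).map v).sum)))
      ≤ .ofReal (Real.exp ((t / r + t ^ 2 * M / 8) * ∑ x ∈ Finset.range Ls.sum, v (base + x))) := by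
  induction Ls generalizing base with
  | nil => simp [avgChoice, deletedFrom]
  | cons L Ls ih =>
    simp only [List.sum_cons] at hv0 hvM ⊢
    set c := t / r + t ^ 2 * M / 8
    have hL : r ≤ L := hLs L (by simp)
    have hstep : ∀ x, avgChoice Ls (fun xs => .ofReal (Real.exp
        (t * ((deletedFrom base (L :: Ls) (x :: xs)).map v).sum)))
        ≤ .ofReal (Real.exp (t * v (base + x))) *
          .ofReal (Real.exp (c * ∑ x ∈ Finset.range Ls.sum, v (base + L + x))) := by
      intro x
      refine le_trans (le_of_eq ?_) (mul_le_mul_right (ih (base := base + L)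
        (fun l hl => hLs l (List.mem_cons_of_mem _ hl)) (fun j hj => hv0 j (by omega))
        (fun j hj => hvM j (by omega))) _)
      rw [← avgChoice_const_mul]
      congr 1
      funext xs
      rw [← ENNReal.ofReal_mul (Real.exp_pos _).le, ← Real.exp_add]
      simp [deletedFrom, mul_add]
    have hhoeff := sum_exp_div_le hr hL (f := fun x => v (base + x)) (M := M) ht
      (fun x hx => hv0 _ (by omega)) (fun x hx => hvM _ (by omega))
    calc avgChoice (L :: Ls) (fun xs => .ofReal (Real.exp
          (t * ((deletedFrom base (L :: Ls) xs).map v).sum)))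
        ≤ (∑ x ∈ Finset.range L, .ofReal (Real.exp (t * v (base + x))) *
          .ofReal (Real.exp (c * ∑ x ∈ Finset.range Ls.sum, v (base + L + x)))) / L := by
          unfold avgChoice
          gcongr with x
          exact hstep x
      _ = .ofReal ((∑ x ∈ Finset.range L, Real.exp (t * v (base + x))) / L) *
          .ofReal (Real.exp (c * ∑ x ∈ Finset.range Ls.sum, v (base + L + x))) := by
          rw [← Finset.sum_mul, ENNReal.mul_div_right_comm,
            ENNReal.ofReal_div_of_pos (by exact_mod_cast hr.trans_le hL),
            ENNReal.ofReal_sum_of_nonneg fun _ _ => (Real.exp_pos _).le, ENNReal.ofReal_natCast]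
      _ ≤ .ofReal (Real.exp (c * ∑ x ∈ Finset.range L, v (base + x))) *
          .ofReal (Real.exp (c * ∑ x ∈ Finset.range Ls.sum, v (base + L + x))) := by
          gcongr
      _ = .ofReal (Real.exp (c * ∑ x ∈ Finset.range (L + Ls.sum), v (base + x))) := by
          rw [← ENNReal.ofReal_mul (Real.exp_pos _).le, ← Real.exp_add, ← mul_add,
            Finset.sum_range_add]
          simp only [add_assoc]

/-- The Chernoff bound for one objective of total weight `S`: with
`M = η * S`, the choice `t = 4 * ε / M` minimizes the exponent `S * (t ^ 2 * M / 8 - t * ε)`. -/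
theorem avgChoice_indicator_le {r : ℕ} (hr : 0 < r) {v : ℕ → ℝ} {ε η S : ℝ} (hε : 0 < ε)
    (hη : 0 < η) {Ls : List ℕ} (hLs : ∀ L ∈ Ls, r ≤ L) (hS : S = ∑ x ∈ Finset.range Ls.sum, v x)
    (hv0 : ∀ j < Ls.sum, 0 ≤ v j) (hvM : ∀ j < Ls.sum, v j ≤ η * S) :
    avgChoice Ls ({xs | (ε * r + 1) * S < r * ∑ j ∈ Finset.range Ls.sum,
        if j ∈ deletedFrom 0 Ls xs then v j else 0}.indicator 1)
      ≤ .ofReal (Real.exp (-(2 * ε ^ 2 / η))) := by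
  have hr' : (0 : ℝ) < r := by exact_mod_cast hr
  have hS0 : 0 ≤ S := hS ▸ Finset.sum_nonneg fun x hx => hv0 x (Finset.mem_range.1 hx)
  rcases hS0.eq_or_lt with hS0 | hS0
  -- If `S = 0`, then all weights vanish and the strict inequality cannot hold.
  · refine (avgChoice_mono (b' := fun _ => 0) fun xs _ => ?_).trans ?_
    · rw [Set.indicator_of_notMem]
      · simp only [Set.mem_ofPred_eq, not_lt, ← hS0, mul_zero] at hvM ⊢
        refine mul_nonpos_of_nonneg_of_nonpos hr'.le (Finset.sum_nonpos fun j hj => ?_)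
        split_ifs
        exacts [hvM j (Finset.mem_range.1 hj), le_rfl]
    · rw [avgChoice_const fun L hL => hr.trans_le (hLs L hL)]
      exact zero_le
  · have hM : 0 < η * S := mul_pos hη hS0
    set t := 4 * ε / (η * S) with ht
    have ht0 : 0 < t := by positivity
    have hexp := avgChoice_exp_le hr (M := η * S) ht0.le hLs (base := 0) (v := v)
      (by simpa using hv0) (by simpa using hvM)
    simp only [zero_add, ← hS] at hexp
    calc avgChoice Ls ({xs | (ε * r + 1) * S < r * ∑ j ∈ Finset.range Ls.sum,
            if j ∈ deletedFrom 0 Ls xs then v j else 0}.indicator 1)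
        ≤ avgChoice Ls (fun xs => .ofReal (Real.exp (-(t * ((ε + 1 / r) * S)))) *
            .ofReal (Real.exp (t * ((deletedFrom 0 Ls xs).map v).sum))) := by
          refine avgChoice_mono fun xs hxs => ?_
          refine indicator_one_le fun h => ?_
          rw [Set.mem_ofPred_eq, sum_ite_mem_deletedFrom hxs] at h
          rw [← ENNReal.ofReal_mul (Real.exp_pos _).le, ← Real.exp_add,
            ← ENNReal.ofReal_one]
          refine ENNReal.ofReal_le_ofReal (Real.one_le_exp ?_)
          rw [neg_add_eq_sub, ← mul_sub]
          refine mul_nonneg ht0.le (sub_nonneg.2 ?_)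
          refine le_of_mul_le_mul_left (le_trans (le_of_eq ?_) h.le) hr'
          field_simp
      _ ≤ .ofReal (Real.exp (-(t * ((ε + 1 / r) * S)))) *
            .ofReal (Real.exp ((t / r + t ^ 2 * (η * S) / 8) * S)) := by
          rw [avgChoice_const_mul]
          gcongr
      _ = .ofReal (Real.exp (-(2 * ε ^ 2 / η))) := by
          rw [← ENNReal.ofReal_mul (Real.exp_pos _).le, ← Real.exp_add]
          congr 2
          rw [ht]
          field_simp
          ring

theorem eta_pos {k : ℕ} (hk : 2 ≤ k) {ε : ℝ} (hε : 0 < ε) : 0 < eta k ε := by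
  have : 0 < Real.log k := Real.log_pos (by exact_mod_cast hk)
  unfold eta
  positivity

theorem exp_neg_div_eta {k : ℕ} (hk : 2 ≤ k) {ε : ℝ} (hε : 0 < ε) :
    Real.exp (-(2 * ε ^ 2 / eta k ε)) = ((k : ℝ) ^ 4)⁻¹ := by
  have hlog : 0 < Real.log k := Real.log_pos (by exact_mod_cast hk)
  have h : 2 * ε ^ 2 / eta k ε = (4 : ℕ) * Real.log k := by
    unfold eta
    field_simp
    norm_num
  rw [h, Real.exp_neg, Real.exp_nat_mul, Real.exp_log (by positivity)]

/-- A round fails with probability at most `k * k⁻⁴`. -/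
theorem avgChoice_fails_le {r k n : ℕ} {wmem₀ : ℕ → ℝ} (hr : 0 < r) (hk : 2 ≤ k)
    (hε : 0 < wmem₀ 0) {Ls : List ℕ} (hLs : ∀ L ∈ Ls, r ≤ L) (hn : Ls.sum = n)
    (hv0 : ∀ i < k, ∀ j < n, 0 ≤ cellWeight k wmem₀ i j)
    (hvM : ∀ i < k, ∀ j < n, cellWeight k wmem₀ i j
      ≤ eta k (wmem₀ 0) * ∑ j ∈ Finset.range n, cellWeight k wmem₀ i j) :
    avgChoice Ls (fun xs => {D | ∃ i < k, Fails r k n wmem₀ D i}.indicator 1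
      (deletedFrom 0 Ls xs)) ≤ 1 / 2 := by
  subst hn
  have hone : ∀ i ∈ Finset.range k, avgChoice Ls
      ({xs | Fails r k Ls.sum wmem₀ (deletedFrom 0 Ls xs) i}.indicator 1)
      ≤ .ofReal ((k : ℝ) ^ 4)⁻¹ := by
    intro i hi
    rw [Finset.mem_range] at hi
    rw [← exp_neg_div_eta hk hε]
    exact avgChoice_indicator_le hr hε (eta_pos hk hε) hLs rfl (hv0 i hi) (hvM i hi)
  calc avgChoice Ls (fun xs => {D | ∃ i < k, Fails r k Ls.sum wmem₀ D i}.indicator 1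
        (deletedFrom 0 Ls xs))
      ≤ avgChoice Ls (fun xs => ∑ i ∈ Finset.range k,
          {xs | Fails r k Ls.sum wmem₀ (deletedFrom 0 Ls xs) i}.indicator 1 xs) := by
        refine avgChoice_mono fun xs _ => indicator_one_le ?_
        rintro ⟨i, hi, h⟩
        refine le_trans ?_ (Finset.single_le_sum (fun _ _ => zero_le) (Finset.mem_range.2 hi))
        rw [Set.indicator_of_mem (by exact h), Pi.one_apply]
    _ ≤ ∑ _i ∈ Finset.range k, .ofReal ((k : ℝ) ^ 4)⁻¹ := by
        rw [avgChoice_sum]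
        exact Finset.sum_le_sum hone
    _ = .ofReal (k * ((k : ℝ) ^ 4)⁻¹) := by
        rw [Finset.sum_const, Finset.card_range, nsmul_eq_mul,
          ENNReal.ofReal_mul (Nat.cast_nonneg k), ENNReal.ofReal_natCast]
    _ ≤ .ofReal (1 / 2) := by
        refine ENNReal.ofReal_le_ofReal ?_
        have hk' : (2 : ℝ) ≤ k := by exact_mod_cast hk
        rw [← div_eq_mul_inv, div_le_iff₀ (by positivity)]
        have h3 : (2 : ℝ) ≤ (k : ℝ) ^ 3 :=
          hk'.trans (le_self_pow₀ (by linarith) (by norm_num))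
        nlinarith
    _ = 1 / 2 := by
        rw [ENNReal.ofReal_div_of_pos (by norm_num)]
        simp

/-! ### Cycle covers with one edge deleted from each cycle -/

theorem map_fst_cycleArcs {n : ℕ} (c : List (Fin n)) : (cycleArcs c).map Prod.fst = c :=
  List.map_fst_zip (by simp)

theorem length_cycleArcs {n : ℕ} (c : List (Fin n)) : (cycleArcs c).length = c.length := by
  simp [cycleArcs]

theorem map_fst_flatMap_cycleArcs {n : ℕ} (cs : List (List (Fin n))) :
    (cs.flatMap cycleArcs).map Prod.fst = cs.flatten := by
  rw [List.map_flatMap]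
  simp only [map_fst_cycleArcs, List.flatMap_id']

theorem pathArcs_eq_dropLast {n : ℕ} (p : List (Fin n)) : pathArcs p = (cycleArcs p).dropLast := by
  cases p with
  | nil => rfl
  | cons a p =>
    refine List.ext_getElem (by simp [pathArcs, cycleArcs]) fun i h₁ h₂ => ?_
    have : i < p.length := by simpa [pathArcs] using h₁
    simp [pathArcs, cycleArcs, List.getElem_append_left this]

theorem cycleArcs_rotate {n : ℕ} (c : List (Fin n)) (i : ℕ) :
    cycleArcs (c.rotate i) = (cycleArcs c).rotate i := by
  rw [cycleArcs, cycleArcs, List.zip_eq_zipWith, List.zip_eq_zipWith,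
    List.zipWith_rotate_distrib _ _ _ _ (by simp), List.rotate_rotate, List.rotate_rotate,
    add_comm]

/-- Starting the cycle `c` behind its `x`-th edge and cutting it open deletes exactly that edge. -/
theorem mem_pathArcs_rotate {n : ℕ} {c : List (Fin n)} {x : ℕ} (hx : x < c.length)
    {a : Fin n × Fin n} :
    a ∈ pathArcs (c.rotate (x + 1)) ↔ ∃ j, j ≠ x ∧ (cycleArcs c)[j]? = some a := by
  have hx' : x < (cycleArcs c).length := by rwa [length_cycleArcs]
  have : pathArcs (c.rotate (x + 1)) = (cycleArcs c).drop (x + 1) ++ (cycleArcs c).take x := by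
    rw [pathArcs_eq_dropLast, cycleArcs_rotate, List.rotate_eq_drop_append_take (by omega),
      List.take_succ_eq_append_getElem hx', ← List.append_assoc, List.dropLast_concat]
  rw [this, List.mem_append, List.mem_iff_getElem?, List.mem_iff_getElem?]
  constructor
  · rintro (⟨j, hj⟩ | ⟨j, hj⟩)
    · exact ⟨x + 1 + j, by omega, by simpa using hj⟩
    · rw [List.getElem?_take] at hj
      split_ifs at hj with h
      exact ⟨j, h.ne, hj⟩
  · rintro ⟨j, hjx, hj⟩
    rcases hjx.lt_or_gt with h | h
    · exact .inr ⟨j, by rw [List.getElem?_take, if_pos h, hj]⟩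
    · refine .inl ⟨j - (x + 1), ?_⟩
      rw [List.getElem?_drop, ← hj]
      congr 1
      omega

/-- If the `x`-th edge is deleted from each cycle, with `x` the corresponding entry of `xs`, then
the edges of the resulting paths are those at the positions not listed in `deletedFrom`. -/
theorem mem_flatMap_pathArcs_iff {n : ℕ} {cs : List (List (Fin n))} {xs : List ℕ}
    (h : List.Forall₂ (· < ·) xs (cs.map List.length)) (base : ℕ) {a : Fin n × Fin n} :
    a ∈ (List.zipWith (fun c x => c.rotate (x + 1)) cs xs).flatMap pathArcs ↔
      ∃ j, base + j ∉ deletedFrom base (cs.map List.length) xs ∧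
        (cs.flatMap cycleArcs)[j]? = some a := by
  induction cs generalizing xs base with
  | nil => simp
  | cons c cs ih =>
    rw [List.map_cons] at h
    cases h with
    | @cons x _ xs _ hx hxs =>
    rw [List.zipWith_cons_cons, List.flatMap_cons, List.mem_append, mem_pathArcs_rotate hx,
      ih hxs (base + c.length), List.flatMap_cons, List.map_cons]
    simp only [deletedFrom, List.mem_cons, not_or, List.getElem?_append, length_cycleArcs]
    constructor
    · rintro (⟨j, hjx, hj⟩ | ⟨j, hjD, hj⟩)
      · have hjc : j < c.length := by
          rw [← length_cycleArcs]
          exact (List.getElem?_eq_some_iff.1 hj).1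
        refine ⟨j, ⟨by omega, fun hmem => ?_⟩, by rwa [if_pos hjc]⟩
        have := (mem_deletedFrom hxs hmem).1
        omega
      · refine ⟨c.length + j, ⟨by omega, by rwa [← add_assoc]⟩, ?_⟩
        rw [if_neg (by omega), Nat.add_sub_cancel_left, hj]
    · rintro ⟨j, ⟨hjx, hjD⟩, hj⟩
      split_ifs at hj with hjc
      · exact .inl ⟨j, by omega, hj⟩
      · refine .inr ⟨j - c.length, ?_, hj⟩
        rwa [show base + c.length + (j - c.length) = base + j by omega]

theorem flatten_zipWith_rotate_perm {α : Type*} {cs : List (List α)} {xs : List ℕ}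
    (h : xs.length = cs.length) :
    (List.zipWith (fun c x => c.rotate (x + 1)) cs xs).flatten.Perm cs.flatten := by
  induction cs generalizing xs with
  | nil => simp
  | cons c cs ih =>
    cases xs with
    | nil => simp at h
    | cons x xs =>
      simp only [List.zipWith_cons_cons, List.flatten_cons]
      exact (List.rotate_perm c (x + 1)).append (ih (by simpa using h))

namespace CycleCover
variable {r n k : ℕ} {E : Type} (f : Fin n × Fin n → E) (C : CycleCover r n)

theorem sum_lengths : (C.cycles.map List.length).sum = n := by
  have hfin : C.cycles.flatten.toFinset = Finset.univ :=
    Finset.eq_univ_of_forall fun v => List.mem_toFinset.2 (C.spanning v)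
  rw [← List.length_flatten, ← List.toFinset_card_of_nodup C.nodup, hfin, Finset.card_univ,
    Fintype.card_fin]

theorem length_edgeList : (C.edgeList f).length = n := by
  rw [edgeList, List.length_map, ← List.length_map (f := Prod.fst), map_fst_flatMap_cycleArcs,
    List.length_flatten, sum_lengths]

theorem nodup_flatMap_cycleArcs : (C.cycles.flatMap cycleArcs).Nodup := by
  refine List.Nodup.of_map Prod.fst ?_
  rw [map_fst_flatMap_cycleArcs]
  exact C.nodup

theorem cycle_eq_of_mem {c c' : List (Fin n)} (hc : c ∈ C.cycles) (hc' : c' ∈ C.cycles) {v : Fin n}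
    (hv : v ∈ c) (hv' : v ∈ c') : c = c' := by
  by_contra hne
  have : Std.Symm (List.Disjoint (α := Fin n)) := ⟨fun _ _ h => h.symm⟩
  exact (List.nodup_flatten.1 C.nodup).2.forall hc hc' hne hv hv'

theorem nodup_edgeList_directed (C : DirectedCycleCover n) : (C.edgeList directedEdge).Nodup := by
  have : (directedEdge : Fin n × Fin n → _) = id := rfl
  rw [edgeList, this, List.map_id]
  exact C.nodup_flatMap_cycleArcs

theorem exists_of_mem_cycleArcs {p : List (Fin n)} {a b : Fin n} (h : (a, b) ∈ cycleArcs p) :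
    ∃ i < p.length, p[i]? = some a ∧ p[(i + 1) % p.length]? = some b := by
  obtain ⟨i, hi, h⟩ := List.mem_iff_getElem.1 h
  rw [length_cycleArcs] at hi
  have hmod : (i + 1) % p.length < p.length := Nat.mod_lt _ (by omega)
  simp only [cycleArcs, List.getElem_zip, List.getElem_rotate, Prod.mk.injEq] at h
  exact ⟨i, hi, by rw [List.getElem?_eq_getElem hi, h.1],
    by rw [List.getElem?_eq_getElem hmod, h.2]⟩

/-- In a cycle of length at least three, an arc and its reverse cannot both occur. -/
theorem nodup_edgeList_undirected (C : UndirectedCycleCover n) :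
    (C.edgeList undirectedEdge).Nodup := by
  refine List.Nodup.map_on ?_ C.nodup_flatMap_cycleArcs
  rintro ⟨a, b⟩ hab ⟨a', b'⟩ hab' heq
  rcases Sym2.eq_iff.1 heq with ⟨h₁, h₂⟩ | ⟨h₁, h₂⟩
  · exact Prod.ext h₁ h₂
  · exfalso
    simp only at h₁ h₂
    subst h₁ h₂
    obtain ⟨c, hc, hab⟩ := List.mem_flatMap.1 hab
    obtain ⟨c', hc', hba⟩ := List.mem_flatMap.1 hab'
    obtain ⟨i, hi, hia, hib⟩ := exists_of_mem_cycleArcs hab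
    obtain ⟨j, hj, hjb, hja⟩ := exists_of_mem_cycleArcs hba
    obtain rfl : c = c' := C.cycle_eq_of_mem hc hc' (List.mem_of_getElem? hia)
      (List.mem_of_getElem? hja)
    have hnd : c.Nodup := (List.nodup_flatten.1 C.nodup).1 c hc
    have h1 : j = (i + 1) % c.length := (List.getElem?_inj hj hnd).1 (hjb.trans hib.symm)
    have h2 : i = (j + 1) % c.length := (List.getElem?_inj hi hnd).1 (hia.trans hja.symm)
    have h3 := C.length_ge c hc
    have hmod : ∀ x < c.length, (x + 1) % c.length = if x + 1 < c.length then x + 1 else 0 := by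
      intro x hx
      split_ifs with h
      · exact Nat.mod_eq_of_lt h
      · rw [show x + 1 = c.length by omega, Nat.mod_self]
    rw [hmod i hi] at h1
    rw [hmod j hj] at h2
    split_ifs at h1 h2 <;> omega

end CycleCover

/-! ### Input and output -/

/-- The weights are stored edge by edge, `k` weights per edge. -/
theorem getD_flatMap_ofFn {α : Type*} {k : ℕ} (F : α → Fin k → ℝ) (l : List α) {j : ℕ}
    (hj : j < l.length) (i : Fin k) :
    (l.flatMap fun e => List.ofFn fun i => F e i).getD (i + j * k) 0 = F l[j] i := by
  induction l generalizing j with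
  | nil => simp at hj
  | cons e l ih =>
    rw [List.flatMap_cons]
    cases j with
    | zero =>
      rw [List.getD_append _ _ _ _ (by simp)]
      simp [List.getD]
    | succ j =>
      rw [List.getD_append_right _ _ _ _ (by simp; nlinarith [i.2])]
      rw [List.length_ofFn, show i + (j + 1) * k - k = i + j * k by
        rw [add_mul, one_mul]; omega]
      simpa using ih (by simpa using hj)

section
variable {r n k : ℕ} {E : Type} (f : Fin n × Fin n → E) (ε : ℝ) (C : CycleCover r n)
  (w : Fin k → E → ℝ)

theorem cellWeight_initState (i : Fin k) (j : Fin (C.edgeList f).length) :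
    cellWeight k (initState f ε C w).wmem i j = w i ((C.edgeList f).get j) := by
  have := getD_flatMap_ofFn (fun e i => w i e) (C.edgeList f) j.2 i
  rw [List.get_eq_getElem, ← this]
  simp only [cellWeight, initState, inputWeights]
  rw [show 1 + (i : ℕ) + j * k = (i + j * k) + 1 by ring, List.getD_cons_succ]

theorem mem_initState_length {q : ℕ} (hq : q < (C.cycles.map List.length).length) :
    (initState f ε C w).mem (3 + q) = (C.cycles.map List.length)[q] := by
  simp only [initState, inputWords]
  rw [List.append_assoc, List.getD_append_right _ _ _ _ (by simp),
    List.getD_append _ _ _ _ (by simpa using hq)]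
  simp only [List.length_map] at hq
  simp [hq, List.getD]

variable [DecidableEq E]

theorem weight_edges (hnd : (C.edgeList f).Nodup) (i : Fin k) : weight w i (C.edges f)
    = ∑ j ∈ Finset.range n, cellWeight k (initState f ε C w).wmem i j := by
  have hedges : C.edges f = Finset.univ.image (C.edgeList f).get := by
    ext e
    simp [CycleCover.edges, List.mem_iff_get]
  have hsum := Finset.sum_range (n := (C.edgeList f).length)
    fun j => cellWeight k (initState f ε C w).wmem i j
  simp only [cellWeight_initState] at hsum
  rw [weight, hedges, Finset.sum_image fun a _ b _ h => List.nodup_iff_injective_get.1 hnd h,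
    ← hsum, C.length_edgeList f]

theorem weight_outputEdges (hnd : (C.edgeList f).Nodup) {D : List ℕ} {s : MachineState}
    (h0 : s.reg 0 = 3 + C.cycles.length) (hD : Marks n C.cycles.length D s) (i : Fin k) :
    weight w i (outputEdges f C s)
      = ∑ j ∈ Finset.range n, if j ∈ D then 0 else cellWeight k (initState f ε C w).wmem i j := by
  have hsum := Finset.sum_range (n := (C.edgeList f).length)
    fun j => if j ∈ D then 0 else cellWeight k (initState f ε C w).wmem i j
  rw [weight, outputEdges,
    Finset.sum_image fun a _ b _ h => List.nodup_iff_injective_get.1 hnd h, Finset.sum_filter,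
    ← congrArg Finset.range (C.length_edgeList f), hsum]
  refine Finset.sum_congr rfl ?_
  intro j _
  have hj : (j : ℕ) < n := j.2.trans_eq (C.length_edgeList f)
  rw [h0, hD j hj, cellWeight_initState]
  by_cases h : (j : ℕ) ∈ D <;> simp [h]

theorem outputEdges_subset (s : MachineState) : outputEdges f C s ⊆ C.edges f := by
  intro e he
  obtain ⟨j, -, rfl⟩ := Finset.mem_image.1 he
  exact List.mem_toFinset.2 (List.get_mem _ _)

theorem isPathCollection_outputEdges {xs : List ℕ}
    (hxs : List.Forall₂ (· < ·) xs (C.cycles.map List.length)) {s : MachineState}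
    (h0 : s.reg 0 = 3 + C.cycles.length)
    (hD : Marks n C.cycles.length (deletedFrom 0 (C.cycles.map List.length) xs) s) :
    IsPathCollection f (outputEdges f C s) := by
  refine ⟨List.zipWith (fun c x => c.rotate (x + 1)) C.cycles xs, ?_, ?_⟩
  · rw [(flatten_zipWith_rotate_perm (by simpa using hxs.length_eq)).nodup_iff]
    exact C.nodup
  · ext e
    simp only [outputEdges, Finset.mem_image, Finset.mem_filter, Finset.mem_univ, true_and,
      List.mem_toFinset, List.mem_map, mem_flatMap_pathArcs_iff hxs 0, zero_add]
    constructor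
    · rintro ⟨j, hj, rfl⟩
      have hjn : (j : ℕ) < n := j.2.trans_eq (C.length_edgeList f)
      have hjl : (j : ℕ) < (C.cycles.flatMap cycleArcs).length := by
        simpa [CycleCover.edgeList] using j.2
      rw [h0, hD j hjn] at hj
      exact ⟨(C.cycles.flatMap cycleArcs)[(j : ℕ)], ⟨j, by simpa using hj,
        List.getElem?_eq_getElem hjl⟩, (List.getElem_map f).symm⟩
    · rintro ⟨a, ⟨j, hjD, hj⟩, rfl⟩
      obtain ⟨hjl, hja⟩ := List.getElem?_eq_some_iff.1 hj
      have hjl' : j < (C.edgeList f).length := by simpa [CycleCover.edgeList] using hjl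
      refine ⟨⟨j, hjl'⟩, ?_, by simp [CycleCover.edgeList, hja]⟩
      rw [h0, hD j (by rwa [← C.length_edgeList f]), if_neg hjD]
      exact one_ne_zero

theorem isDecomposition_outputEdges (hnd : (C.edgeList f).Nodup) (hr : 0 < r) {xs : List ℕ}
    (hxs : List.Forall₂ (· < ·) xs (C.cycles.map List.length)) {s : MachineState}
    (h0 : s.reg 0 = 3 + C.cycles.length)
    (hD : Marks n C.cycles.length (deletedFrom 0 (C.cycles.map List.length) xs) s)
    (hok : ∀ i < k, ¬ Fails r k n (initState f ε C w).wmem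
      (deletedFrom 0 (C.cycles.map List.length) xs) i) :
    IsDecomposition f (1 - 1 / r - ε) w (C.edges f) (outputEdges f C s) := by
  refine ⟨outputEdges_subset f C s, isPathCollection_outputEdges f C hxs h0 hD, fun i => ?_⟩
  have hr' : (0 : ℝ) < r := by exact_mod_cast hr
  have h := not_lt.1 (hok i i.2)
  have hε : (initState f ε C w).wmem 0 = ε := rfl
  rw [hε] at h
  rw [weight_edges f ε C w hnd, weight_outputEdges f ε C w hnd h0 hD]
  set D := deletedFrom 0 (C.cycles.map List.length) xs
  set v := cellWeight k (initState f ε C w).wmem i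
  have hsplit : ∑ j ∈ Finset.range n, v j = (∑ j ∈ Finset.range n, if j ∈ D then v j else 0)
      + ∑ j ∈ Finset.range n, if j ∈ D then 0 else v j := by
    rw [← Finset.sum_add_distrib]
    refine Finset.sum_congr rfl fun j _ => ?_
    split_ifs <;> simp
  set R := ∑ j ∈ Finset.range n, if j ∈ D then v j else 0
  set W := ∑ j ∈ Finset.range n, v j
  have hR : R ≤ (1 / r + ε) * W := by
    refine le_of_mul_le_mul_left (h.trans_eq ?_) hr'
    field_simp
    ring
  linarith
end

/-! ### The running time -/

/-- One round of the program: mark all edges as kept, delete one edge from each cycle, test. Here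
`a` bounds `g` at the start of the next round, and `L :: Ls` are the lengths of the cycles. -/
theorem le_of_round {r k n m : ℕ} {mem₀ : ℕ → ℕ} {wmem₀ : ℕ → ℝ} {g : MachineState → ℝ≥0∞}
    (hg : (decomposer r).StepBounded g) (hk : 0 < k) {a : ℝ≥0∞} {L : ℕ} {Ls : List ℕ}
    (hpos : ∀ l ∈ L :: Ls, 0 < l) (hn : (L :: Ls).sum = n)
    (hm : (L :: Ls).length = m)
    (hlen : ∀ j (hj : j < (L :: Ls).length), mem₀ (3 + j) = (L :: Ls)[j])
    (ha : ∀ s, s.pc = 16 → Ready r k n m mem₀ wmem₀ s → g s ≤ a)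
    (hgood : ∀ xs, List.Forall₂ (· < ·) xs (L :: Ls) → ∀ s, s.pc = 48 →
      Ready r k n m mem₀ wmem₀ s →
      Marks n m (deletedFrom 0 (L :: Ls) xs) s →
      (∀ i < k, ¬ Fails r k n wmem₀ (deletedFrom 0 (L :: Ls) xs) i) → g s = 0)
    {s : MachineState} (hpc : s.pc = 16) (hs : Ready r k n m mem₀ wmem₀ s) :
    g s ≤ ((4 + 3 * n + 8 * m + (9 + 8 * n) * k : ℕ) : ℝ≥0∞) +
      a * avgChoice (L :: Ls) (fun xs => {D | ∃ i < k, Fails r k n wmem₀ D i}.indicator 1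
        (deletedFrom 0 (L :: Ls) xs)) := by
  have hn0 : 0 < n := by
    have := hpos L (by simp)
    simp only [List.sum_cons] at hn
    omega
  have hcheck : ∀ xs, List.Forall₂ (· < ·) xs (L :: Ls) → ∀ s, s.pc = 30 →
      Ready r k n m mem₀ wmem₀ s → Marks n m (deletedFrom 0 (L :: Ls) xs) s →
      g s ≤ ((1 + (9 + 8 * n) * k : ℕ) : ℝ≥0∞) + a *
        {D | ∃ i < k, Fails r k n wmem₀ D i}.indicator 1 (deletedFrom 0 (L :: Ls) xs) := by
    rintro xs hxs ⟨pc, reg, mem, wreg, wmem⟩ hpc hs hD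
    obtain rfl : pc = 30 := hpc
    obtain ⟨h0, h1, h2, h3, h10, h12, h15, hw0, hw1, hw7, hmem, hw⟩ := hs
    simp only at *
    refine hg.le_of_run_of_le (run_startCheck ..) ?_ rfl
    obtain ⟨d, rfl⟩ : ∃ d, k = d + 1 := ⟨k - 1, by omega⟩
    refine le_of_check hg hn0 ha (hgood xs hxs) d (i := 0) (by omega) (by simp) rfl ?_ hD ?_
    · constructor <;> simp [*]
      exact hmem
    · simp [*]
  have hchoose : ∀ s, s.pc = 20 → Ready r k n m mem₀ wmem₀ s → Marks n m [] s →
      g s ≤ ((2 + (8 * m + (1 + (9 + 8 * n) * k)) : ℕ) : ℝ≥0∞) + a * avgChoice (L :: Ls)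
        (fun xs => {D | ∃ i < k, Fails r k n wmem₀ D i}.indicator 1
          (deletedFrom 0 (L :: Ls) xs)) := by
    rintro ⟨pc, reg, mem, wreg, wmem⟩ hpc hs hD
    obtain rfl : pc = 20 := hpc
    obtain ⟨h0, h1, h2, h3, h10, h12, h15, hw0, hw1, hw7, hmem, hw⟩ := hs
    simp only at *
    refine hg.le_of_run_of_le (run_startChoose ..) ?_ rfl
    rw [← avgChoice_const_mul, Nat.cast_add (8 * m), add_assoc,
      ← avgChoice_const hpos ((1 + (9 + 8 * n) * k : ℕ) : ℝ≥0∞), ← avgChoice_add,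
      show 8 * m = 8 * (L :: Ls).length by rw [hm]]
    refine le_of_choose (k := k) (wmem₀ := wmem₀) hg Ls (q := 0) (base := 0) (D := []) ?_ hlen
      (by omega) hpos rfl ?_ ?_ ?_ hD
    · simpa using hcheck
    · constructor <;> simp [*]
      exact hmem
    · simp [*]
    · simp [*]
  obtain ⟨pc, reg, mem, wreg, wmem⟩ := s
  obtain rfl : pc = 16 := hpc
  obtain ⟨h0, h1, h2, h3, h10, h12, h15, hw0, hw1, hw7, hmem, hw⟩ := hs
  simp only at *
  refine hg.le_of_run_of_le (c' := 3 * n + (2 + (8 * m + (1 + (9 + 8 * n) * k)))) (run_start ..)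
    ?_ (by ring)
  rw [Nat.cast_add (3 * n), add_assoc]
  obtain ⟨d, rfl⟩ : ∃ d, n = d + 1 := ⟨n - 1, by omega⟩
  refine le_of_fill hg hchoose d (j := 0) (by omega) rfl ?_ ?_ (by simp)
  · constructor <;> simp [*]
    exact hmem
  · simp [*]

section
variable {r n k : ℕ} {E : Type} (f : Fin n × Fin n → E) (ε : ℝ) (C : CycleCover r n)
  (w : Fin k → E → ℝ)

theorem inputSize_eq : inputSize f ε C w = 4 + C.cycles.length + n + n * k := by
  have hsum : C.cycles.flatten.length = n := by rw [List.length_flatten, C.sum_lengths]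
  simp only [inputSize, inputWords, inputWeights, List.length_append, List.length_map,
    List.length_cons, List.length_nil, List.length_flatMap, List.length_ofFn, List.map_const',
    List.sum_replicate, C.length_edgeList f, smul_eq_mul, List.bind_eq_flatMap, List.pure_def, hsum]
  ring

variable [DecidableEq E]

/-- The halted states with a correct output. -/
def goalStates : Set MachineState :=
  {s | (decomposer r).Halted s ∧
    IsDecomposition f (1 - 1 / r - ε) w (C.edges f) (outputEdges f C s)}

/-- The expected time from the start of a round until the program halts. -/
theorem delay_round_le (hr : 0 < r) (hk : 2 ≤ k) (hn : 0 < n) (hε : 0 < ε)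
    (hnd : (C.edgeList f).Nodup) (h0 : ∀ i, ∀ e ∈ C.edges f, 0 ≤ w i e)
    (hlight : IsLight (1 / eta k ε) (C.edges f) w) (N : ℕ) {s : MachineState} (hpc : s.pc = 16)
    (hs : Ready r k n C.cycles.length (initState f ε C w).mem (initState f ε C w).wmem s) :
    (decomposer r).delay (goalStates f ε C w) N s ≤
      2 * ((4 + 3 * n + 8 * C.cycles.length + (9 + 8 * n) * k : ℕ) : ℝ≥0∞) := by
  have hlen : ∀ L ∈ C.cycles.map List.length, r ≤ L := by
    intro L hL
    obtain ⟨c, hc, rfl⟩ := List.mem_map.1 hL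
    exact C.length_ge c hc
  have hedge : ∀ j < n, ∃ e ∈ C.edges f,
      ∀ i : Fin k, cellWeight k (initState f ε C w).wmem i j = w i e := by
    intro j hj
    have hj' : j < (C.edgeList f).length := by rwa [C.length_edgeList f]
    exact ⟨_, List.mem_toFinset.2 (List.get_mem _ ⟨j, hj'⟩),
      fun i => cellWeight_initState f ε C w i ⟨j, hj'⟩⟩
  have hfails := avgChoice_fails_le (r := r) (n := n) (wmem₀ := (initState f ε C w).wmem)
    hr hk hε hlen C.sum_lengths
    (by
      intro i hi j hj
      obtain ⟨e, he, hw⟩ := hedge j hj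
      rw [hw ⟨i, hi⟩]
      exact h0 _ e he)
    (by
      intro i hi j hj
      obtain ⟨e, he, hw⟩ := hedge j hj
      rw [hw ⟨i, hi⟩, ← weight_edges f ε C w hnd ⟨i, hi⟩]
      refine (hlight e he ⟨i, hi⟩).trans_eq ?_
      rw [div_div_eq_mul_div, div_one, mul_comm]
      rfl)
  refine Program.delay_le_of_restart (S := {s | s.pc = 16 ∧ Ready r k n C.cycles.length
    (initState f ε C w).mem (initState f ε C w).wmem s}) hfails ?_ s ⟨hpc, hs⟩
  rintro a ha s ⟨hpc, hs⟩
  have hgood : ∀ xs, List.Forall₂ (· < ·) xs (C.cycles.map List.length) → ∀ s, s.pc = 48 →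
      Ready r k n C.cycles.length (initState f ε C w).mem (initState f ε C w).wmem s →
      Marks n C.cycles.length (deletedFrom 0 (C.cycles.map List.length) xs) s →
      (∀ i < k, ¬ Fails r k n (initState f ε C w).wmem
        (deletedFrom 0 (C.cycles.map List.length) xs) i) →
      (decomposer r).delay (goalStates f ε C w) N s = 0 := by
    intro xs hxs s hpc hs hD hok
    have hhalt : (decomposer r).Halted s := hpc.ge
    exact Program.delay_eq_zero (Q := goalStates f ε C w)
      ⟨hhalt, isDecomposition_outputEdges f ε C w hnd hr hxs hs.reg_zero hD hok⟩ hhalt N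
  have hmem := fun q hq => mem_initState_length f ε C w (q := q) hq
  have hsum := C.sum_lengths
  have hm : (C.cycles.map List.length).length = C.cycles.length := List.length_map _
  generalize C.cycles.map List.length = lens at *
  obtain _ | ⟨L, Ls⟩ := lens
  · rw [List.sum_nil] at hsum
    omega
  · exact le_of_round ((decomposer r).stepBounded_delay _ N) (by omega)
      (fun l hl => hr.trans_le (hlen l hl)) hsum hm hmem (fun s hpc hs => ha s ⟨hpc, hs⟩) hgood
      hpc hs

theorem isDecomposition_of_no_vertices {r k : ℕ} {E : Type} [DecidableEq E] (f : Fin 0 × Fin 0 → E)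
    (C : CycleCover r 0) (α : ℝ) (w : Fin k → E → ℝ) (s : MachineState) :
    IsDecomposition f α w (C.edges f) (outputEdges f C s) := by
  have hedges : C.edges f = ∅ := by
    rw [CycleCover.edges, List.eq_nil_of_length_eq_zero (C.length_edgeList f), List.toFinset_nil]
  have hsub := outputEdges_subset f C s
  have hout : outputEdges f C s = ∅ := Finset.subset_empty.1 (hedges ▸ hsub)
  exact ⟨hsub, ⟨[], by simp, by simp [hout]⟩, fun i => by simp [hedges, hout, weight]⟩

theorem delay_initState_le (hr : 0 < r) (hk : 2 ≤ k) (hε : 0 < ε)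
    (hnd : (C.edgeList f).Nodup) (h0 : ∀ i, ∀ e ∈ C.edges f, 0 ≤ w i e)
    (hlight : IsLight (1 / eta k ε) (C.edges f) w) (N : ℕ) :
    (decomposer r).delay (goalStates f ε C w) N (initState f ε C w) ≤
      ((40 * inputSize f ε C w : ℕ) : ℝ≥0∞) := by
  have hg := (decomposer r).stepBounded_delay (goalStates f ε C w) N
  obtain ⟨s, hrun, hpc, hmem, hwmem, h0', h1, h2, h3, h10, h12, h15, hw0, hw1, hw7⟩ :=
    run_setup r (initState f ε C w).mem (initState f ε C w).wmem
  refine (hg.le_of_run hrun).trans ?_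
  have hm : (initState f ε C w).mem 2 = C.cycles.length := rfl
  have hn : (initState f ε C w).mem 1 = n := rfl
  have hk' : (initState f ε C w).mem 0 = k := rfl
  rw [hm, hn] at hpc
  rw [inputSize_eq]
  rcases Nat.eq_zero_or_pos n with hn0 | hn0
  · -- Without vertices, `k` is not part of the input size, so that no round may be executed.
    subst hn0
    rw [if_neg (by omega)] at hpc
    have hhalt : (decomposer r).Halted (s.goto 48) := le_rfl
    have hjump : (decomposer r).run 1 s = some (s.goto 48) := by
      obtain ⟨pc, reg, mem, wreg, wmem⟩ := s
      obtain rfl : pc = 15 := hpc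
      rfl
    have hzero : (decomposer r).delay (goalStates f ε C w) N (s.goto 48) = 0 :=
      Program.delay_eq_zero (Q := goalStates f ε C w)
        ⟨hhalt, isDecomposition_of_no_vertices f C _ w _⟩ hhalt N
    refine (add_le_add le_rfl (hg.le_of_run hjump)).trans ?_
    rw [hzero, add_zero, ← Nat.cast_add]
    exact Nat.cast_le.2 (by omega)
  · rw [if_pos (by omega)] at hpc
    have hround := delay_round_le f ε C w hr hk hn0 hε hnd h0 hlight N hpc
      ⟨by rw [h0', hm, add_comm], h1, by rw [h2, hk'], by rw [h3, hm, hn, add_comm 3], h10,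
        by rw [h12, hk'], h15, by rw [hw0, Nat.cast_one], hw1, hw7, fun j _ => by rw [hmem], hwmem⟩
    refine (add_le_add le_rfl hround).trans ?_
    rw [← Nat.cast_ofNat (R := ℝ≥0∞) (n := 2), ← Nat.cast_mul, ← Nat.cast_add]
    refine Nat.cast_le.2 ?_
    have : k ≤ n * k := Nat.le_mul_of_pos_left k hn0
    nlinarith

theorem lasVegasDecomposes_decomposer (hr : 0 < r) (hk : 2 ≤ k) (hε : 0 < ε)
    (hnd : (C.edgeList f).Nodup) (h0 : ∀ i, ∀ e ∈ C.edges f, 0 ≤ w i e)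
    (hlight : IsLight (1 / eta k ε) (C.edges f) w) :
    LasVegasDecomposes (decomposer r) 40 f (1 - 1 / r - ε) ε C w := by
  have h := delay_initState_le f ε C w hr hk hε hnd h0 hlight
  exact ⟨fun t s hs hhalt =>
    (Program.mem_of_halted_of_delay_le (ENNReal.natCast_ne_top _) h hs hhalt).2,
    Program.expectedTime_le_of_delay_le (fun _ hs => hs.1) h⟩
end

theorem mainTheorem8 :
    (∃ (M : Program) (K : ℕ), ∀ (ε : ℝ) (k n : ℕ) (C : DirectedCycleCover n)
      (w : Fin k → Fin n × Fin n → ℝ), 0 < ε → 2 ≤ k →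
      (∀ i, ∀ e ∈ C.edges directedEdge, 0 ≤ w i e) →
      IsLight (1 / eta k ε) (C.edges directedEdge) w →
      LasVegasDecomposes M K directedEdge (1 / 2 - ε) ε C w) ∧
    (∃ (M : Program) (K : ℕ), ∀ (ε : ℝ) (k n : ℕ) (C : UndirectedCycleCover n)
      (w : Fin k → Sym2 (Fin n) → ℝ), 0 < ε → 2 ≤ k →
      (∀ i, ∀ e ∈ C.edges undirectedEdge, 0 ≤ w i e) →
      IsLight (1 / eta k ε) (C.edges undirectedEdge) w →
      LasVegasDecomposes M K undirectedEdge (2 / 3 - ε) ε C w) := by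
  refine ⟨⟨decomposer 2, 40, fun ε k n C w hε hk h0 hlight => ?_⟩,
    ⟨decomposer 3, 40, fun ε k n C w hε hk h0 hlight => ?_⟩⟩
  · rw [show (1 / 2 - ε : ℝ) = 1 - 1 / (2 : ℕ) - ε by norm_num]
    exact lasVegasDecomposes_decomposer _ ε C w two_pos hk hε C.nodup_edgeList_directed h0 hlight
  · rw [show (2 / 3 - ε : ℝ) = 1 - 1 / (3 : ℕ) - ε by norm_num]
    exact lasVegasDecomposes_decomposer _ ε C w three_pos hk hε C.nodup_edgeList_undirected h0
      hlight
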